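/- Let $\mathcal O_0=\mathbb C\{x,y\}$, let $\nu_0$ denote the order at $0$, and for $f\in\mathcal O_0$ let $f^\vee(x,y)=\overline{f(\bar x,\bar y)}$. Let $$\eta=\sum_{i=1}^r\lambda_i\frac{df_i}{f_i}+\alpha$$ be a logarithmic $1$-form at $(\mathbb C^2,0)$: the $f_i\in\mathcal O_0$ are irreducible equations of pairwise distinct branches, $\lambda_i\in\mathbb C^*$, and $\alpha$ is a closed germ of holomorphic $1$-form. Put $f=f_1\cdots f_r$ and $\nu_i=\nu_0(f_i)$. Assume that $\eta$ is * *main resonant*: $\sum_i\nu_i\lambda_i=0$; * *1-faithful*: $\nu_0(f\eta)=\nu_0(f)-1$; * *symmetric*: $\alpha$ has real coefficients, and for every $i$ there is $j$ such that $f_i^\vee=0$ and $f_j=0$ define the same branch and $\lambda_j=\overline{\lambda_i}$. **Notation.** Let $\sigma$ be the blow-up of $0\in\mathbb C^2$, with divisor $D=\sigma^{-1}(0)\cong\mathbb P^1_{\mathbb C}$ (the lines through $0$), whose real trace is the set of the real lines. A point $p\in D$ is an *escape point* of a logarithmic form $\eta$ if it does not lie in the tangent cone of the polar set of $\eta$ and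 the strict transform by $\sigma$ of the foliation defined by $\eta$ is not transversal to $D$ at $p$ (it is singular at $p$ or tangent to $D$ at $p$). Given real linear coordinates $(x',y')$ of $\mathbb C^2$, let $t=y'/x'$ be the affine coordinate of $D$, let $a_1,\dots,a_\ell\in\mathbb C$ be the distinct affine points of the tangent cone of the polar set, let $\rho_k$ be the sum of the $\lambda_i\nu_i$ over the $f_i$ with tangent $t=a_k$, and let $P_\eta(t)=\sum_k\rho_k\prod_{j\ne k}(t-a_j)$, the numerator of the escape function $R_\eta(t)=\sum_k\rho_k/(t-a_k)$. The coordinates are *adapted* to $\eta$ if no $f_i$ is tangent to the $y'$-axis and $P_\eta$ is nonzero of degree $\ell-2$. A *1-logarithmic modification* of $\eta$ with parameters $\tau=\{(a_1',\lambda_1'),\dots,(a_s',\lambda_s')\}$, where the $a_i'\in\mathbb C\setminus\{a_1,\dots,a_\ell\}$ are distinct and $\lambda_i'\in\mathbb C^*$, is a form $\eta^\tau=\eta+\sum_{i=1}^s\lambda_i'\,df_i'/f_i'$, where $f_i'\in\mathcal O_0$ is an equation of a smooth branch with tangent $t=a_i'$. It is *symmetric* if $\tau$ is invariant by complex conjugation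 and $\{f_1',\dots,f_s'\}$ is invariant by $f\mapsto f^\vee$; it is *balanced* if $\sum_i\lambda_i'=0$ and $P_{\eta^\tau}$ is nonzero of degree $\ell+s-2$. **Statement.** Real linear coordinates adapted to $\eta$ exist. In any such coordinates, for every $\varepsilon>0$ there is a non-empty finite set of parameters $\tau=\{(a_i',\lambda_i')\}$ as above with $a_i'\in\mathbb R$, $\lambda_i'\in\mathbb Q^*$ and $|\lambda_i'|<\varepsilon$, such that symmetric 1-logarithmic modifications $\eta^\tau$ of $\eta$ with parameters $\tau$ exist, and every one of them is balanced and has no escape points in the real trace of $D$. -/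

import Mathlib

noncomputable section

namespace LogModel

/-- Formal power series in two variables; `X 0 = x`, `X 1 = y`. -/
abbrev Ser : Type := MvPowerSeries (Fin 2) ℂ

/-- Geometric growth of the coefficients, i.e. convergence on some polydisc around the origin. -/
def Converges (f : Ser) : Prop :=
  ∃ C R : ℝ, ∀ n : Fin 2 →₀ ℕ, ‖MvPowerSeries.coeff n f‖ ≤ C * R ^ (n 0 + n 1)

theorem Converges.good {f : Ser} (hf : Converges f) :
    ∃ C R : ℝ, 0 ≤ C ∧ 1 ≤ R ∧
      ∀ n : Fin 2 →₀ ℕ, ‖MvPowerSeries.coeff n f‖ ≤ C * R ^ (n 0 + n 1) := by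
  obtain ⟨C, R, h⟩ := hf
  refine ⟨|C|, max 1 |R|, abs_nonneg _, le_max_left _ _, fun n => (h n).trans ?_⟩
  calc C * R ^ (n 0 + n 1) ≤ |C * R ^ (n 0 + n 1)| := le_abs_self _
    _ = |C| * |R| ^ (n 0 + n 1) := by rw [abs_mul, abs_pow]
    _ ≤ _ := by
      gcongr
      exact le_max_right _ _

theorem Converges.mul {f g : Ser} (hf : Converges f) (hg : Converges g) : Converges (f * g) := by
  obtain ⟨C, R, hC, hR, hf⟩ := hf.good
  obtain ⟨D, S, hD, hS, hg⟩ := hg.good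
  refine ⟨C * D, 2 * (R * S), fun n => ?_⟩
  have hcard : (Finset.HasAntidiagonal.antidiagonal n).card ≤ (n 0 + 1) * (n 1 + 1) := by
    rw [← Finset.card_range (n 0 + 1), ← Finset.card_range (n 1 + 1), ← Finset.card_product]
    refine Finset.card_le_card_of_injOn (fun p => (p.1 0, p.1 1)) ?_ ?_
    · intro p hp
      have hp' := Finset.HasAntidiagonal.mem_antidiagonal.1 hp
      have h0 := DFunLike.congr_fun hp' 0
      have h1 := DFunLike.congr_fun hp' 1
      simp only [Finsupp.add_apply] at h0 h1
      simp only [Finset.coe_product, Set.mem_prod, Finset.coe_range, Set.mem_Iio]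
      omega
    · intro p hp q hq hpq
      have hp' := Finset.HasAntidiagonal.mem_antidiagonal.1 hp
      have hq' := Finset.HasAntidiagonal.mem_antidiagonal.1 hq
      simp only [Prod.mk.injEq] at hpq
      have h1 : p.1 = q.1 := by
        ext k
        fin_cases k
        · exact hpq.1
        · exact hpq.2
      refine Prod.ext h1 ?_
      rw [h1] at hp'
      exact add_left_cancel (hp'.trans hq'.symm)
  have hcard2 : ((Finset.HasAntidiagonal.antidiagonal n).card : ℝ) ≤ 2 ^ (n 0 + n 1) := by
    have h : (n 0 + 1) * (n 1 + 1) ≤ 2 ^ (n 0 + n 1) := by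
      rw [pow_add]
      exact Nat.mul_le_mul (Nat.lt_two_pow_self) (Nat.lt_two_pow_self)
    exact_mod_cast hcard.trans h
  rw [MvPowerSeries.coeff_mul]
  refine (norm_sum_le _ _).trans ?_
  have hterm : ∀ p ∈ Finset.HasAntidiagonal.antidiagonal n,
      ‖MvPowerSeries.coeff p.1 f * MvPowerSeries.coeff p.2 g‖
        ≤ C * D * (R * S) ^ (n 0 + n 1) := by
    intro p hp
    have hp' := Finset.HasAntidiagonal.mem_antidiagonal.1 hp
    have h0 := DFunLike.congr_fun hp' 0
    have h1 := DFunLike.congr_fun hp' 1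
    simp only [Finsupp.add_apply] at h0 h1
    rw [norm_mul]
    calc _ ≤ (C * R ^ (p.1 0 + p.1 1)) * (D * S ^ (p.2 0 + p.2 1)) :=
          mul_le_mul (hf _) (hg _) (norm_nonneg _) (by positivity)
      _ ≤ (C * R ^ (n 0 + n 1)) * (D * S ^ (n 0 + n 1)) := by
          gcongr <;> first | assumption | omega
      _ = _ := by rw [mul_pow]; ring
  refine (Finset.sum_le_card_nsmul _ _ _ hterm).trans ?_
  rw [nsmul_eq_mul]
  calc _ ≤ 2 ^ (n 0 + n 1) * (C * D * (R * S) ^ (n 0 + n 1)) := by gcongr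
    _ = _ := by rw [mul_pow 2 (R * S)]; ring

theorem Converges.add {f g : Ser} (hf : Converges f) (hg : Converges g) : Converges (f + g) := by
  obtain ⟨C, R, hC, hR, hf⟩ := hf.good
  obtain ⟨D, S, hD, hS, hg⟩ := hg.good
  refine ⟨C + D, R * S, fun n => ?_⟩
  rw [map_add]
  refine (norm_add_le _ _).trans ?_
  rw [add_mul]
  refine add_le_add ((hf n).trans ?_) ((hg n).trans ?_)
  · gcongr
    nlinarith
  · gcongr
    nlinarith

theorem converges_C (c : ℂ) : Converges (MvPowerSeries.C c) := by
  refine ⟨‖c‖, 1, fun n => ?_⟩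
  rw [MvPowerSeries.coeff_C]
  split_ifs <;> simp

/-- The ring `𝒪₀ = ℂ{x, y}` of germs of holomorphic functions at the origin of `ℂ²`. -/
def O : Subring Ser where
  carrier := {f | Converges f}
  mul_mem' := Converges.mul
  one_mem' := by simpa using converges_C 1
  add_mem' := Converges.add
  zero_mem' := by simpa using converges_C 0
  neg_mem' := by
    rintro f ⟨C, R, h⟩
    exact ⟨C, R, fun n => by rw [map_neg, norm_neg]; exact h n⟩

/-- The germ `f^∨`, with `f^∨(x, y)` the conjugate of `f` at the conjugate point. -/
def conj (f : O) : O :=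
  ⟨MvPowerSeries.map (starRingEnd ℂ) (f : Ser), by
    obtain ⟨C, R, h⟩ := f.2
    exact ⟨C, R, fun n => by
      rw [MvPowerSeries.coeff_map, RCLike.norm_conj]; exact h n⟩⟩

/-- The order `ν₀(f)`, for nonzero `f`. -/
def ord (f : O) : ℕ := (f : Ser).order.toNat

/-- The initial form of `f`: its homogeneous component of degree `ν₀(f)`. Its zero lines are the
tangent cone of the curve `f = 0`. -/
def initForm (f : O) : MvPolynomial (Fin 2) ℂ :=
  ∑ p ∈ Finset.HasAntidiagonal.antidiagonal (ord f),
    MvPolynomial.monomial (Finsupp.single 0 p.1 + Finsupp.single 1 p.2)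
      (MvPowerSeries.coeff (Finsupp.single 0 p.1 + Finsupp.single 1 p.2) (f : Ser))

/-- A logarithmic `1`-form `η = ∑ i, res i • d(f i) / (f i) + α`, where the `f i` are irreducible
equations of distinct branches, the residues are nonzero and `α = αx dx + αy dy` is holomorphic
and closed. -/
structure LogForm (ι : Type*) where
  f : ι → O
  res : ι → ℂ
  αx : O
  αy : O
  irreducible : ∀ i, Irreducible (f i)
  distinct : ∀ i j, i ≠ j → ¬ Associated (f i) (f j)
  res_ne_zero : ∀ i, res i ≠ 0
  closed : MvPowerSeries.pderiv ℂ 1 (αx : Ser) = MvPowerSeries.pderiv ℂ 0 (αy : Ser)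

namespace LogForm

variable {ι : Type*} [Fintype ι]

/-- The product `f` of the equations of the poles. -/
def F (η : LogForm ι) : Ser := ∏ i, (η.f i : Ser)

/-- The part along the `k`-th coordinate of
`∑ i, res i • (∏ j ≠ i, f j) d(f i)`. -/
def polarPart (η : LogForm ι) (k : Fin 2) : Ser :=
  open Classical in
  ∑ i, η.res i • ((∏ j ∈ Finset.univ.erase i, (η.f j : Ser)) *
    MvPowerSeries.pderiv ℂ k (η.f i : Ser))

/-- The coefficient of `dx` in the holomorphic `1`-form `ω = f η`. -/
def ωx (η : LogForm ι) : Ser := η.polarPart 0 + η.F * (η.αx : Ser)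

/-- The coefficient of `dy` in the holomorphic `1`-form `ω = f η`. -/
def ωy (η : LogForm ι) : Ser := η.polarPart 1 + η.F * (η.αy : Ser)

/-- The weighted balance of residues vanishes. -/
def MainResonant (η : LogForm ι) : Prop := ∑ i, (ord (η.f i) : ℂ) * η.res i = 0

/-- `ν₀(f η) = ν₀(f) - 1`. -/
def OneFaithful (η : LogForm ι) : Prop :=
  min η.ωx.order η.ωy.order + 1 = η.F.order

/-- The set of poles, the residues and `α` are invariant by complex conjugation. -/
def IsSymmetric (η : LogForm ι) : Prop :=
  (∀ i, ∃ j, Associated (conj (η.f i)) (η.f j) ∧ η.res j = starRingEnd ℂ (η.res i)) ∧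
    conj η.αx = η.αx ∧ conj η.αy = η.αy

end LogForm

/-! ### Points of the divisor, transversality, escape points

Points of the divisor `D` of the blow-up at the origin are the lines `[v]`, `v ∈ ℂ² \ 0`.
If `w` is independent of `v`, then `(x, s) ↦ x (v + s w)` is a chart of the blow-up near `[v]`,
centred at `[v]`, in which `D` is `x = 0`. -/

/-- The `k`-th coordinate `v k + s * w k` of `v + s w`, where `s = X 1`. -/
def chartDir (v w : Fin 2 → ℂ) (k : Fin 2) : Ser :=
  MvPowerSeries.C (v k) + MvPowerSeries.C (w k) * MvPowerSeries.X 1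

/-- The composition of `f` with the chart `(x, s) ↦ x (v + s w)`. -/
def pull (v w : Fin 2 → ℂ) (f : Ser) : Ser :=
  MvPowerSeries.subst (fun k : Fin 2 => MvPowerSeries.X 0 * chartDir v w k) f

/-- The foliation which the nonzero form `A dx + B ds` defines at `(x, s) = (0, 0)` is transversal
to `x = 0`: after taking out a common factor, the coefficient of `ds` does not vanish at the
point. In particular the foliation is regular there. -/
def TransversalToDivisor (A B : Ser) : Prop :=
  ∃ g u v : O, g ≠ 0 ∧ A = (g * u : O) ∧ B = (g * v : O) ∧
    MvPowerSeries.constantCoeff (v : Ser) ≠ 0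

namespace LogForm

variable {ι : Type*} [Fintype ι]

/-- The coefficient of `dx` in the pull-back of `ω = f η` to the chart `(x, s) ↦ x (v + s w)`. -/
def pullX (η : LogForm ι) (v w : Fin 2 → ℂ) : Ser :=
  pull v w η.ωx * chartDir v w 0 + pull v w η.ωy * chartDir v w 1

/-- The coefficient of `ds` in the pull-back of `ω = f η` to the chart `(x, s) ↦ x (v + s w)`. -/
def pullS (η : LogForm ι) (v w : Fin 2 → ℂ) : Ser :=
  MvPowerSeries.X 0 * (MvPowerSeries.C (w 0) * pull v w η.ωx + MvPowerSeries.C (w 1) * pull v w η.ωy)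

/-- The point `[v]` of `D` is an escape point of `η`: it lies on the strict transform of no pole,
and the strict transform of the foliation is not transversal to `D` at `[v]`. The choice of the
chart, that is of `w`, is immaterial. -/
def IsEscapePoint (η : LogForm ι) (v : Fin 2 → ℂ) : Prop :=
  v ≠ 0 ∧ (∀ i, MvPolynomial.eval v (initForm (η.f i)) ≠ 0) ∧
    ∃ w : Fin 2 → ℂ, v 0 * w 1 - v 1 * w 0 ≠ 0 ∧
      ¬ TransversalToDivisor (η.pullX v w) (η.pullS v w)

/-- No escape points on the real trace of `D`, which is the set of the lines `[v]` with `v` real. -/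
def NoRealEscapePoints (η : LogForm ι) : Prop :=
  ∀ v : Fin 2 → ℝ, ¬ η.IsEscapePoint (fun k => (v k : ℂ))

/-! ### Escape polynomial

A matrix `E` in `GL₂(ℝ)` gives real linear coordinates `(x', y')`, with `(x, y) = E (x', y')`, and
the affine coordinate `t = y' / x'` on `D`: the value `t` corresponds to the line spanned by
`E (1, t)`, and `t = ∞`, the `y'`-axis, to the line spanned by `E (0, 1)`. -/

/-- The polynomial `t ↦ f_ν (E (1, t))`, where `f_ν` is the initial form of `f`. -/
def _root_.LogModel.conePoly (E : GL (Fin 2) ℝ) (f : O) : Polynomial ℂ :=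
  MvPolynomial.aeval
    (fun k : Fin 2 => Polynomial.C ((E k 0 : ℝ) : ℂ) + Polynomial.C ((E k 1 : ℝ) : ℂ) * Polynomial.X)
    (initForm f)

/-- The points `a₁, …, a_ℓ` of the affine part of the tangent cone of the polar set. -/
def cone (η : LogForm ι) (E : GL (Fin 2) ℝ) : Finset ℂ :=
  open Classical in
  Finset.univ.biUnion fun i => (conePoly E (η.f i)).roots.toFinset

/-- The number `ρ_a`, the sum of `λ_i ν_i` over the poles `f_i` tangent to `t = a`. The initial form
of an irreducible germ is a power of a linear form, so that the multiplicity of `t = a` in the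
tangent cone of `f_i` is `ν_i` if `f_i` is tangent to `t = a`, and `0` otherwise. -/
def rho (η : LogForm ι) (E : GL (Fin 2) ℝ) (a : ℂ) : ℂ :=
  ∑ i, η.res i * ((conePoly E (η.f i)).rootMultiplicity a : ℂ)

/-- The polynomial `P_η(t) = ∑ k, ρ_k ∏ j ≠ k, (t - a_j)`, the numerator of the escape function
`R_η(t) = ∑ k, ρ_k / (t - a_k)`. -/
def escapePoly (η : LogForm ι) (E : GL (Fin 2) ℝ) : Polynomial ℂ :=
  ∑ a ∈ η.cone E, Polynomial.C (η.rho E a) *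
    ∏ b ∈ (η.cone E).erase a, (Polynomial.X - Polynomial.C b)

/-- Coordinates as they are fixed for the study of escape points: no pole is tangent to the
`y'`-axis, and `P_η` has degree `ℓ - 2`. -/
def Adapted (η : LogForm ι) (E : GL (Fin 2) ℝ) : Prop :=
  (∀ i, MvPolynomial.eval (fun k => ((E k 1 : ℝ) : ℂ)) (initForm (η.f i)) ≠ 0) ∧
    η.escapePoly E ≠ 0 ∧ (η.escapePoly E).natDegree + 2 = (η.cone E).card

/-! ### Logarithmic modifications -/

/-- `τ = {(a'₁, λ'₁), …, (a'_s, λ'_s)}` is a set of parameters for a `1`-logarithmic modification. -/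
def IsParameterSet (η : LogForm ι) (E : GL (Fin 2) ℝ) {s : ℕ} (τ : Fin s → ℂ × ℂ) : Prop :=
  Function.Injective (fun i => (τ i).1) ∧ (∀ i, (τ i).1 ∉ η.cone E) ∧ ∀ i, (τ i).2 ≠ 0

/-- `η' = η + ∑ i, λ'_i d(f'_i) / (f'_i)`, where `f'_i` is an equation of a smooth branch with tangent
`t = a'_i`. -/
structure IsModification (η : LogForm ι) (E : GL (Fin 2) ℝ) {s : ℕ} (τ : Fin s → ℂ × ℂ)
    (η' : LogForm (ι ⊕ Fin s)) : Prop where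
  params : η.IsParameterSet E τ
  f_inl : ∀ i, η'.f (Sum.inl i) = η.f i
  res_inl : ∀ i, η'.res (Sum.inl i) = η.res i
  αx_eq : η'.αx = η.αx
  αy_eq : η'.αy = η.αy
  res_inr : ∀ i, η'.res (Sum.inr i) = (τ i).2
  smooth : ∀ i, (η'.f (Sum.inr i) : Ser).order = 1
  tangent : ∀ i, (conePoly E (η'.f (Sum.inr i))).IsRoot (τ i).1

/-- A modification `η'` with parameters `τ` is symmetric: `τ` and the set of the equations `f'_i`
are invariant by complex conjugation. -/
structure IsSymmetricModification (η : LogForm ι) (E : GL (Fin 2) ℝ) {s : ℕ} (τ : Fin s → ℂ × ℂ)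
    (η' : LogForm (ι ⊕ Fin s)) : Prop extends IsModification η E τ η' where
  params_symm : ∀ i, ∃ j, τ j = (starRingEnd ℂ (τ i).1, starRingEnd ℂ (τ i).2)
  eqs_symm : ∀ i, ∃ j, η'.f (Sum.inr j) = conj (η'.f (Sum.inr i))

/-- A modification `η'` with parameters `τ` is balanced: `λ'₁ + … + λ'_s = 0` and the degree of
`P_η'` is `ℓ + s - 2`. -/
def IsBalanced (η : LogForm ι) (E : GL (Fin 2) ℝ) {s : ℕ} (τ : Fin s → ℂ × ℂ)
    (η' : LogForm (ι ⊕ Fin s)) : Prop :=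
  ∑ i, (τ i).2 = 0 ∧ η'.escapePoly E ≠ 0 ∧
    (η'.escapePoly E).natDegree + 2 = (η.cone E).card + s

end LogForm

end LogModel

end

/-! Only the leading part of `f η` matters near the divisor. Let Ω be its component of degree ν₀(f)
- 1, with coefficients `leadForm 0` and `leadForm 1`; it depends on the residues and the initial
forms of the poles, not on α. By Euler's identity the radial contraction of Ω is (∑ νᵢλᵢ) ∏ in(fᵢ),
so main resonance kills it: the blow-up is then transversal to D at every [v] with Ω(v) ≠ 0
(`not_isEscapePoint`). On the affine part of D the form Ω restricts, up to the product of the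
tangent cones, to ∑ λᵢ pᵢ'/pᵢ = P_η/Q, where the pᵢ are the cone polynomials and Q = ∏ (t - a_k)
(`escapePoly_mul_prod`). At t = ∞ the condition Ω ≠ 0 says exactly that P_η is nonzero of degree ℓ -
2 (`exists_leadForm_ne_zero_iff`). Faithfulness gives Ω ≠ 0, hence adapted coordinates: send a
generic real direction to infinity.

What remains is a problem on the real line. By symmetry P and Q are real, with deg P = deg Q - 2,
and a modification replaces P/Q by P/Q + ∑ l_a/(t - a). One needs small rational residues l_a of sum
zero at real points which leave no real zero off the zeros of Q and no drop of degree.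

If z is a simple zero of P/Q with slope c, then c(t - z) + r/(t - z) has no real zero when r has the
sign of c. So a new pole is put at each real zero, with residue of the sign of the slope, and a
compactness argument controls the rest of the line (`exists_residues_at_simple_roots`). Balancing
these residues needs zeros of both slopes, and all real zeros have to be simple. Both are arranged
beforehand by a dipole m/(t - a) - m/(t - b) placed far to the right, where P/Q keeps its sign; it
creates a zero of each slope, and a generic m makes all real zeros simple (`exists_dipole`). Common
factors of P and Q are divided out first (`exists_balanced_residues`). -/

noncomputable section

namespace LogModel

open Polynomial

/-! ### Rational functions with simple poles: denominators and numerators. -/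

section PolarNum

variable {K : Type*} [Field K]

/-- The monic polynomial with simple zeros at the points of `S`. -/
def poleProd (S : Finset K) : K[X] := ∏ b ∈ S, (X - C b)

theorem poleProd_monic (S : Finset K) : (poleProd S).Monic :=
  monic_prod_of_monic _ _ fun b _ => monic_X_sub_C b

theorem natDegree_poleProd (S : Finset K) : (poleProd S).natDegree = S.card := by
  simp [poleProd]

theorem eval_poleProd_eq_zero (S : Finset K) (t : K) : (poleProd S).eval t = 0 ↔ t ∈ S := by
  simp [poleProd, eval_prod, Finset.prod_eq_zero_iff, sub_eq_zero]

theorem map_poleProd {L : Type*} [Field L] [DecidableEq L] (φ : K →+* L) (S : Finset K) :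
    (poleProd S).map φ = poleProd (S.image φ) := by
  rw [poleProd, poleProd, Finset.prod_image fun a _ b _ h => φ.injective h, Polynomial.map_prod]
  simp

variable [DecidableEq K]

/-- The numerator of `∑ a ∈ S, c a / (X - a)` over the denominator `poleProd S`. -/
def polarNum (S : Finset K) (c : K → K) : K[X] :=
  ∑ a ∈ S, C (c a) * ∏ b ∈ S.erase a, (X - C b)

theorem map_polarNum {L : Type*} [Field L] [DecidableEq L] (φ : K →+* L) (S : Finset K)
    (c : K → K) (d : L → L) (h : ∀ a ∈ S, d (φ a) = φ (c a)) :
    (polarNum S c).map φ = polarNum (S.image φ) d := by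
  rw [polarNum, polarNum, Finset.sum_image fun a _ b _ h => φ.injective h, Polynomial.map_sum]
  refine Finset.sum_congr rfl fun a ha => ?_
  rw [Polynomial.map_mul, map_C, h a ha, ← Finset.image_erase φ.injective]
  exact congrArg _ (map_poleProd φ (S.erase a))

theorem polarNum_congr {S : Finset K} {c d : K → K} (h : ∀ a ∈ S, c a = d a) :
    polarNum S c = polarNum S d :=
  Finset.sum_congr rfl fun a ha => by rw [h a ha]

theorem poleProd_union {S T : Finset K} (h : Disjoint S T) :
    poleProd (S ∪ T) = poleProd S * poleProd T :=
  Finset.prod_union h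

/-- Addition of two fractions with coprime denominators; this is how the escape polynomial changes
when poles are added. -/
theorem polarNum_union {S T : Finset K} (h : Disjoint S T) (c : K → K) :
    polarNum (S ∪ T) c = polarNum S c * poleProd T + poleProd S * polarNum T c := by
  rw [polarNum, Finset.sum_union h, polarNum, polarNum, Finset.sum_mul, Finset.mul_sum]
  congr 1
  · refine Finset.sum_congr rfl fun a ha => ?_
    have hT : a ∉ T := Finset.disjoint_left.1 h ha
    rw [Finset.erase_union_distrib, Finset.erase_eq_of_notMem hT,
      Finset.prod_union (h.mono_left (Finset.erase_subset _ _)), mul_assoc]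
    rfl
  · refine Finset.sum_congr rfl fun a ha => ?_
    have hS : a ∉ S := Finset.disjoint_right.1 h ha
    rw [Finset.erase_union_distrib, Finset.erase_eq_of_notMem hS,
      Finset.prod_union (h.mono_right (Finset.erase_subset _ _)), mul_left_comm]
    rfl

theorem eval_polarNum {S : Finset K} (c : K → K) {t : K} (ht : t ∈ S) :
    (polarNum S c).eval t = c t * (poleProd (S.erase t)).eval t := by
  rw [polarNum, eval_finsetSum, Finset.sum_eq_single t]
  · simp [poleProd]
  · intro b hb hbt
    rw [eval_mul, eval_prod]
    refine mul_eq_zero_of_right _ (Finset.prod_eq_zero (Finset.mem_erase.2 ⟨hbt.symm, ht⟩) ?_)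
    simp
  · exact fun h => absurd ht h

theorem natDegree_polarNum_le (S : Finset K) (c : K → K) :
    (polarNum S c).natDegree ≤ S.card - 1 := by
  refine natDegree_sum_le_of_forall_le _ _ fun a ha => ?_
  refine (natDegree_C_mul_le _ _).trans ?_
  simp [Finset.card_erase_of_mem ha]

theorem coeff_polarNum (S : Finset K) (c : K → K) :
    (polarNum S c).coeff (S.card - 1) = ∑ a ∈ S, c a := by
  rw [polarNum, finsetSum_coeff]
  refine Finset.sum_congr rfl fun a ha => ?_
  have h := (poleProd_monic (S.erase a)).coeff_natDegree
  rw [natDegree_poleProd, Finset.card_erase_of_mem ha] at h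
  rw [coeff_C_mul]
  exact (congrArg _ h).trans (mul_one _)

/-- The coefficient of degree |S| - 1 is the sum of the residues. Balanced residues therefore gain
one degree, which is what keeps the perturbation under control at infinity. -/
theorem natDegree_polarNum_le_of_sum_eq_zero {S : Finset K} {c : K → K} (h : ∑ a ∈ S, c a = 0) :
    (polarNum S c).natDegree ≤ S.card - 2 := by
  have h1 := natDegree_polarNum_le S c
  by_contra! hlt
  have h2 : (polarNum S c).natDegree = S.card - 1 := by omega
  have h3 := coeff_polarNum S c
  rw [h, ← h2, coeff_natDegree, leadingCoeff_eq_zero] at h3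
  rw [h3, natDegree_zero] at hlt
  omega

end PolarNum

/-! ### Positivity and sign changes of real polynomials. -/

section RealLine

/-- Near ±∞ the comparison of degrees bounds |B| by a multiple of A. On the remaining compact set
where B ≤ 0, A is positive, so -B/A is continuous and bounded. -/
theorem exists_pos_forall_le_mul_of_degree_le {A B : ℝ[X]} (hdeg : B.degree ≤ A.degree)
    (hA : ∀ t, 0 ≤ A.eval t) (hB : ∀ t, A.eval t = 0 → 0 < B.eval t) :
    ∃ M : ℝ, 0 < M ∧ ∀ t, B.eval t ≤ 0 → -B.eval t ≤ M * A.eval t := by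
  obtain ⟨c₁, h₁⟩ := (isBigO_atTop_of_degree_le _ _ hdeg).bound
  obtain ⟨c₂, h₂⟩ := (isBigO_atBot_of_degree_le _ _ hdeg).bound
  obtain ⟨r₁, h₁⟩ := Filter.eventually_atTop.1 h₁
  obtain ⟨r₂, h₂⟩ := Filter.eventually_atBot.1 h₂
  have hK : IsCompact (Set.Icc r₂ r₁ ∩ {t | B.eval t ≤ 0}) :=
    isCompact_Icc.inter_right (isClosed_le B.continuous continuous_const)
  have hpos : ∀ t, B.eval t ≤ 0 → 0 < A.eval t := fun t ht =>
    lt_of_le_of_ne (hA t) fun h => absurd (hB t h.symm) (not_lt.2 ht)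
  obtain ⟨c₃, h₃⟩ := hK.bddAbove_image (f := fun t => -B.eval t / A.eval t)
    (ContinuousOn.div B.continuous.neg.continuousOn A.continuous.continuousOn
      fun t ht => (hpos t ht.2).ne')
  refine ⟨|c₁| + |c₂| + |c₃| + 1, by positivity, fun t ht => ?_⟩
  have hAt := hpos t ht
  have key : ∀ c : ℝ, |c| ≤ |c₁| + |c₂| + |c₃| + 1 → -B.eval t ≤ c * A.eval t →
      -B.eval t ≤ (|c₁| + |c₂| + |c₃| + 1) * A.eval t := fun c hc h =>
    h.trans (mul_le_mul_of_nonneg_right ((le_abs_self c).trans hc) hAt.le)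
  have hn : ∀ c : ℝ, ‖B.eval t‖ ≤ c * ‖A.eval t‖ → -B.eval t ≤ c * A.eval t := fun c h => by
    rw [Real.norm_eq_abs, Real.norm_eq_abs, abs_of_pos hAt] at h
    exact (neg_le_abs _).trans h
  have p₁ := abs_nonneg c₁
  have p₂ := abs_nonneg c₂
  have p₃ := abs_nonneg c₃
  rcases le_total r₁ t with h | h
  · exact key c₁ (by linarith) (hn _ (h₁ t h))
  rcases le_total t r₂ with h' | h'
  · exact key c₂ (by linarith) (hn _ (h₂ t h'))
  · refine key c₃ (by linarith) ?_
    have := h₃ (Set.mem_image_of_mem _ ⟨⟨h', h⟩, ht⟩)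
    exact (div_le_iff₀ hAt).1 this

/-- A small multiple of `B` does not destroy the positivity of `A`, provided that `B` is positive
at the zeros of `A` and does not dominate `A` at infinity. -/
theorem exists_forall_eval_add_mul_pos {A B : ℝ[X]} (hdeg : B.degree ≤ A.degree)
    (hA : ∀ t, 0 ≤ A.eval t) (hB : ∀ t, A.eval t = 0 → 0 < B.eval t) :
    ∃ δ : ℝ, 0 < δ ∧ ∀ x : ℝ, 0 < x → x < δ → ∀ t, 0 < A.eval t + x * B.eval t := by
  obtain ⟨M, hM, h⟩ := exists_pos_forall_le_mul_of_degree_le hdeg hA hB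
  refine ⟨1 / M, by positivity, fun x hx hxM t => ?_⟩
  rcases lt_or_ge 0 (B.eval t) with hb | hb
  · nlinarith [hA t, mul_pos hx hb]
  · have hAt : 0 < A.eval t :=
      lt_of_le_of_ne (hA t) fun h => absurd (hB t h.symm) (not_lt.2 hb)
    have h1 := h t hb
    have h2 : x * M < 1 := (lt_div_iff₀ hM).1 hxM
    nlinarith

/-- A polynomial which is positive at `x` and negative at `y > x` has a zero in between at which
its derivative is negative, if the zeros in between are simple. -/
theorem exists_root_derivative_neg {f : ℝ[X]} {x y : ℝ} (hxy : x < y) (hx : 0 < f.eval x)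
    (hy : f.eval y < 0)
    (hs : ∀ t, x < t → t < y → f.eval t = 0 → f.derivative.eval t ≠ 0) :
    ∃ t, x < t ∧ t < y ∧ f.eval t = 0 ∧ f.derivative.eval t < 0 := by
  have hK : IsCompact (Set.Icc x y ∩ {t | 0 ≤ f.eval t}) :=
    isCompact_Icc.inter_right (isClosed_le continuous_const f.continuous)
  -- z is the last point of [x, y] with f ≥ 0. It is a zero, and the difference quotients to its
  -- right are nonpositive, so simplicity makes the derivative negative.
  obtain ⟨z, ⟨⟨hxz, hzy⟩, hz0⟩, hz⟩ := hK.exists_isGreatest ⟨x, ⟨le_refl _, hxy.le⟩, hx.le⟩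
  have hz0 : 0 ≤ f.eval z := hz0
  have hzy' : z < y := lt_of_le_of_ne hzy fun h => by rw [h] at hz0; linarith
  have hneg : ∀ t, z < t → t ≤ y → f.eval t < 0 := fun t h1 h2 => by
    by_contra! h
    exact absurd (hz ⟨⟨hxz.trans h1.le, h2⟩, h⟩) (not_le.2 h1)
  have hz00 : f.eval z = 0 := by
    refine le_antisymm ?_ hz0
    have hc : Filter.Tendsto (fun t => f.eval t) (nhdsWithin z (Set.Ioi z)) (nhds (f.eval z)) :=
      f.continuous.continuousAt.continuousWithinAt
    refine le_of_tendsto hc ?_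
    filter_upwards [Ioc_mem_nhdsGT hzy'] with t ht using (hneg t ht.1 ht.2).le
  have hxz' : x < z := lt_of_le_of_ne hxz fun h => by rw [← h] at hz00; linarith
  refine ⟨z, hxz', hzy', hz00, lt_of_le_of_ne ?_ (hs z hxz' hzy' hz00)⟩
  have hd := (f.hasDerivAt z).hasDerivWithinAt (s := Set.Ioi z)
  rw [hasDerivWithinAt_iff_tendsto_slope' (by simp)] at hd
  refine le_of_tendsto hd ?_
  filter_upwards [Ioc_mem_nhdsGT hzy'] with t ht
  rw [slope_def_field, hz00, sub_zero]
  exact div_nonpos_of_nonpos_of_nonneg (hneg t ht.1 ht.2).le (by linarith [ht.1])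

theorem exists_root_derivative_pos {f : ℝ[X]} {x y : ℝ} (hxy : x < y) (hx : f.eval x < 0)
    (hy : 0 < f.eval y)
    (hs : ∀ t, x < t → t < y → f.eval t = 0 → f.derivative.eval t ≠ 0) :
    ∃ t, x < t ∧ t < y ∧ f.eval t = 0 ∧ 0 < f.derivative.eval t := by
  obtain ⟨t, h1, h2, h3, h4⟩ := exists_root_derivative_neg (f := -f) hxy (by simpa using hx)
    (by simpa using hy) fun t h1 h2 h3 => by simpa using hs t h1 h2 (by simpa using h3)
  exact ⟨t, h1, h2, by simpa using h3, by simpa using h4⟩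

theorem exists_rat_pos_lt_notMem {δ : ℝ} (hδ : 0 < δ) {B : Set ℝ} (hB : B.Finite) :
    ∃ q : ℚ, 0 < q ∧ (q : ℝ) < δ ∧ (q : ℝ) ∉ B := by
  obtain ⟨r, hr0, hr⟩ := exists_rat_btwn hδ
  have hr0' : (0 : ℚ) < r := by exact_mod_cast hr0
  have hfin : {q : ℚ | (q : ℝ) ∈ B}.Finite := hB.preimage Rat.cast_injective.injOn
  obtain ⟨q, hq, hqB⟩ := (Set.Ioo_infinite hr0').exists_notMem_finite hfin
  exact ⟨q, hq.1, lt_trans (by exact_mod_cast hq.2) hr, hqB⟩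

end RealLine

/-! ### Removing real zeros by small balanced residues. -/

section RealLine

/-- Adding poles with small balanced rational residues at the simple real zeros of `P / Q` removes
all the real zeros. -/
theorem exists_residues_at_simple_roots {P Q : ℝ[X]} (hP : P ≠ 0)
    (hdeg : P.natDegree + 2 = Q.natDegree)
    (hs : ∀ t, P.eval t = 0 → P.derivative.eval t * Q.eval t ≠ 0)
    (hup : ∃ t, P.eval t = 0 ∧ 0 < P.derivative.eval t * Q.eval t)
    (hdown : ∃ t, P.eval t = 0 ∧ P.derivative.eval t * Q.eval t < 0) {ε : ℝ} (hε : 0 < ε) :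
    ∃ w : ℝ → ℚ, (∀ t ∈ P.roots.toFinset, w t ≠ 0 ∧ |(w t : ℝ)| < ε) ∧
      ∑ t ∈ P.roots.toFinset, w t = 0 ∧
      (P * poleProd P.roots.toFinset +
        Q * polarNum P.roots.toFinset fun t => (w t : ℝ)).natDegree
          = P.natDegree + P.roots.toFinset.card ∧
      ∀ t, (P * poleProd P.roots.toFinset +
        Q * polarNum P.roots.toFinset fun t => (w t : ℝ)).eval t ≠ 0 := by
  classical
  set T := P.roots.toFinset with hT
  have hmem : ∀ t, t ∈ T ↔ P.eval t = 0 := fun t => by simp [hT, hP]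
  -- U and D collect the zeros at which P/Q has positive and negative slope: at a zero of P the
  -- derivative of P/Q has the sign of P'Q.
  set U := T.filter fun t => 0 < P.derivative.eval t * Q.eval t with hU
  set D := T.filter fun t => ¬ 0 < P.derivative.eval t * Q.eval t with hD
  have hUpos : 0 < U.card := by
    obtain ⟨t, h0, h1⟩ := hup
    exact Finset.card_pos.2 ⟨t, Finset.mem_filter.2 ⟨(hmem t).2 h0, h1⟩⟩
  have hDpos : 0 < D.card := by
    obtain ⟨t, h0, h1⟩ := hdown
    exact Finset.card_pos.2 ⟨t, Finset.mem_filter.2 ⟨(hmem t).2 h0, not_lt.2 h1.le⟩⟩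
  have hUD : U.card + D.card = T.card := Finset.card_filter_add_card_filter_not _
  -- Weight #D on U and -#U on D: the signs are those of the slopes and the total is zero. All
  -- weights are nonzero because both sets are nonempty.
  set w : ℝ → ℚ := fun t =>
    if 0 < P.derivative.eval t * Q.eval t then (D.card : ℚ) else -(U.card : ℚ) with hw
  have hwsum : ∑ t ∈ T, w t = 0 := by
    rw [← Finset.sum_filter_add_sum_filter_not T fun t => 0 < P.derivative.eval t * Q.eval t]
    rw [Finset.sum_congr rfl (g := fun _ => (D.card : ℚ))
        (fun t ht => if_pos (Finset.mem_filter.1 ht).2),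
      Finset.sum_congr rfl (s₁ := T.filter fun t => ¬ 0 < P.derivative.eval t * Q.eval t)
        (g := fun _ => -(U.card : ℚ)) (fun t ht => if_neg (Finset.mem_filter.1 ht).2),
      Finset.sum_const, Finset.sum_const, ← hU, ← hD]
    simp only [nsmul_eq_mul]
    ring
  have hwsum' : ∑ t ∈ T, (w t : ℝ) = 0 := by exact_mod_cast hwsum
  have hw0 : ∀ t, w t ≠ 0 := fun t => by
    simp only [hw]
    split_ifs
    · exact_mod_cast hDpos.ne'
    · exact neg_ne_zero.2 (by exact_mod_cast hUpos.ne')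
  have hwle : ∀ t, |(w t : ℝ)| ≤ T.card := fun t => by
    simp only [hw]
    split_ifs
    · rw [Rat.cast_natCast, Nat.abs_cast]; exact_mod_cast (by omega)
    · rw [Rat.cast_neg, abs_neg, Rat.cast_natCast, Nat.abs_cast]; exact_mod_cast (by omega)
  have hwsign : ∀ t ∈ T, 0 < (w t : ℝ) * (P.derivative.eval t * Q.eval t) := fun t ht => by
    have h0 := hs t ((hmem t).1 ht)
    simp only [hw]
    split_ifs with h
    · refine mul_pos ?_ h
      rw [Rat.cast_natCast]; exact_mod_cast hDpos
    · refine mul_pos_of_neg_of_neg ?_ (lt_of_le_of_ne (not_lt.1 h) h0)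
      rw [Rat.cast_neg, Rat.cast_natCast, neg_lt_zero]; exact_mod_cast hUpos
  set Z := poleProd T with hZ
  set N := polarNum T fun t => (w t : ℝ) with hN
  have hNdeg : N.natDegree ≤ T.card - 2 := natDegree_polarNum_le_of_sum_eq_zero hwsum'
  have hZdeg : Z.natDegree = T.card := natDegree_poleProd T
  obtain ⟨H, hH⟩ : Z ∣ P := by
    refine Finset.prod_dvd_of_coprime ?_ fun t ht => dvd_iff_isRoot.2 ((hmem t).1 ht)
    intro a _ b _ hab
    exact isCoprime_X_sub_C_of_isUnit_sub (sub_ne_zero.2 hab).isUnit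
  have hZ0 : Z ≠ 0 := (poleProd_monic T).ne_zero
  have hH0 : H ≠ 0 := fun h => hP (by rw [hH, h, mul_zero])
  have hPdeg : P.natDegree = T.card + H.natDegree := by
    rw [hH, natDegree_mul hZ0 hH0, hZdeg]
  -- With Z_t the product of the other factors, N(t) = w(t) Z_t(t) and P'(t) = Z_t(t) H(t). Hence
  -- HNQ = w P'Q at t, which is positive by the choice of signs.
  have hB : ∀ t, (P ^ 2).eval t = 0 → 0 < (H * N * Q).eval t := by
    intro t ht
    have ht : t ∈ T := (hmem t).2 (by simpa using ht)
    have h1 : N.eval t = w t * (poleProd (T.erase t)).eval t := eval_polarNum _ ht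
    have h2 : P.derivative.eval t = (poleProd (T.erase t)).eval t * H.eval t := by
      have h3 : Z = (X - C t) * poleProd (T.erase t) :=
        (Finset.mul_prod_erase T (fun b => X - C b) ht).symm
      have h4 : P = (X - C t) * (poleProd (T.erase t) * H) := by rw [← mul_assoc, ← h3, ← hH]
      rw [show derivative P = _ from congrArg derivative h4, derivative_mul, derivative_X_sub_C]
      simp only [eval_add, eval_mul, eval_sub, eval_X, eval_C, sub_self, zero_mul,
        add_zero, one_mul]
    have h3 := hwsign t ht
    rw [h2] at h3
    rw [eval_mul, eval_mul, h1]
    linarith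
  -- deg H = deg P - |T|, deg N ≤ |T| - 2 by the balance, and deg Q = deg P + 2: the sum is at most
  -- 2 deg P.
  have hdegle : (H * N * Q).degree ≤ (P ^ 2).degree := by
    refine degree_le_of_natDegree_le ?_ |>.trans
      (degree_eq_natDegree (pow_ne_zero 2 hP)).ge
    refine natDegree_mul_le.trans ?_
    have := natDegree_mul_le (p := H) (q := N)
    rw [natDegree_pow]
    omega
  obtain ⟨δ, hδ, hpos⟩ := exists_forall_eval_add_mul_pos hdegle
    (fun t => by rw [eval_pow]; positivity) hB
  set c := (Q * N).coeff (P.natDegree + T.card) with hc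
  have hTpos : (0 : ℝ) < T.card := by exact_mod_cast (by omega : 0 < T.card)
  -- x scales all the weights. The excluded value is the one at which the top coefficients of PZ and
  -- x Q N cancel.
  obtain ⟨x, hx0, hx, hxc⟩ := exists_rat_pos_lt_notMem (δ := min δ (ε / T.card))
    (lt_min hδ (div_pos hε hTpos)) (Set.finite_singleton (-P.leadingCoeff / c))
  have hx0' : (0 : ℝ) < x := by exact_mod_cast hx0
  have hscale : (polarNum T fun t => ((x * w t : ℚ) : ℝ)) = C (x : ℝ) * N := by
    rw [hN, polarNum, polarNum, Finset.mul_sum]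
    refine Finset.sum_congr rfl fun a _ => ?_
    rw [Rat.cast_mul, C_mul, mul_assoc]
  refine ⟨fun t => x * w t, fun t _ => ⟨mul_ne_zero hx0.ne' (hw0 t), ?_⟩, ?_, ?_, ?_⟩
  · rw [Rat.cast_mul, abs_mul, abs_of_pos hx0']
    have h1 : (x : ℝ) * T.card < ε := (lt_div_iff₀ hTpos).1 (lt_of_lt_of_le hx (min_le_right _ _))
    exact lt_of_le_of_lt (mul_le_mul_of_nonneg_left (hwle t) hx0'.le) h1
  · rw [← Finset.mul_sum, hwsum, mul_zero]
  · rw [hscale]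
    refine le_antisymm ?_ (le_natDegree_of_ne_zero ?_)
    · refine natDegree_add_le_of_degree_le ?_ ?_
      · exact natDegree_mul_le.trans (by rw [hZdeg])
      · refine natDegree_mul_le.trans ?_
        have := natDegree_C_mul_le (x : ℝ) N
        have : 2 ≤ T.card := by omega
        omega
    · rw [coeff_add, mul_left_comm, coeff_C_mul, ← hc]
      have h1 : (P * Z).coeff (P.natDegree + T.card) = P.leadingCoeff := by
        rw [← hZdeg, coeff_mul_add_eq_of_natDegree_le le_rfl le_rfl, coeff_natDegree,
          (poleProd_monic T).coeff_natDegree, mul_one]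
      rw [h1]
      intro h
      have hc0 : c ≠ 0 := fun h0 => by
        rw [h0, mul_zero, add_zero, leadingCoeff_eq_zero] at h
        exact hP h
      apply hxc
      rw [Set.mem_singleton_iff, eq_div_iff hc0]
      linarith
  · intro t ht
    have h1 := hpos x hx0' (lt_of_lt_of_le hx (min_le_left _ _)) t
    rw [hscale] at ht
    -- Multiplying the new numerator by H = P/Z turns it into P² + x H N Q, which is positive on the
    -- whole line.
    have h2 : H * (P * Z + Q * (C (x : ℝ) * N)) = P ^ 2 + C (x : ℝ) * (H * N * Q) := by
      linear_combination (-P) * hH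
    have h3 := congrArg (eval t) h2
    rw [eval_mul, ht, mul_zero, eval_add, eval_mul (p := C (x : ℝ)), eval_C] at h3
    linarith

/-- A generic small dipole makes the real zeros of `P / Q` simple and disjoint from a given finite
set, and produces zeros of both signs. -/
theorem exists_dipole {P Q : ℝ[X]} (hPQ : IsCoprime P Q)
    (hdeg : P.natDegree + 2 = Q.natDegree) (hlead : 0 < P.leadingCoeff * Q.leadingCoeff)
    {G : Set ℝ} (hG : G.Finite) {ε : ℝ} (hε : 0 < ε) :
    ∃ (a b : ℝ) (m : ℚ) (P₁ Q₁ : ℝ[X]), a ≠ b ∧ a ∉ G ∧ b ∉ G ∧ 0 < m ∧ (m : ℝ) < ε ∧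
      P₁ = P * ((X - C a) * (X - C b)) + C ((m : ℝ) * (a - b)) * Q ∧
      Q₁ = Q * ((X - C a) * (X - C b)) ∧ P₁ ≠ 0 ∧ P₁.natDegree = Q.natDegree ∧
      P₁.eval a ≠ 0 ∧ P₁.eval b ≠ 0 ∧
      (∀ t, P₁.eval t = 0 → t ∉ G) ∧
      (∀ t, P₁.eval t = 0 → P₁.derivative.eval t * Q₁.eval t ≠ 0) ∧
      (∃ t, P₁.eval t = 0 ∧ 0 < P₁.derivative.eval t * Q₁.eval t) ∧
      ∃ t, P₁.eval t = 0 ∧ P₁.derivative.eval t * Q₁.eval t < 0 := by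
  have hP : P ≠ 0 := fun h => by simp [h] at hlead
  have hQ : Q ≠ 0 := fun h => by simp [h] at hlead
  have htend := tendsto_atTop_of_leadingCoeff_nonneg (P * Q)
    (natDegree_pos_iff_degree_pos.1 (by rw [natDegree_mul hP hQ]; omega))
    (by rw [leadingCoeff_mul]; exact hlead.le)
  obtain ⟨M₀, hM₀⟩ := Filter.eventually_atTop.1 (htend.eventually_gt_atTop 0)
  obtain ⟨M₁, hM₁⟩ := hG.bddAbove
  -- Beyond M the function P/Q is positive and there is no point of G.
  obtain ⟨M, hM, hMG⟩ : ∃ M : ℝ, (∀ x, M ≤ x → 0 < P.eval x * Q.eval x) ∧ ∀ x ∈ G, x ≤ M :=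
    ⟨max M₀ M₁, fun x hx => by simpa using hM₀ x ((le_max_left _ _).trans hx),
      fun x hx => (hM₁ hx).trans (le_max_right _ _)⟩
  have hQne : ∀ x, M ≤ x → Q.eval x ≠ 0 := fun x hx h => by
    have := hM x hx
    rw [h, mul_zero] at this
    exact lt_irrefl _ this
  -- With poles at M + 2 and M + 3, the product (x - a)(x - b) equals 2 at both test points M + 1
  -- and M + 4, and a - b = -1.
  obtain ⟨a, ha⟩ : ∃ a, a = M + 2 := ⟨_, rfl⟩
  obtain ⟨b, hb⟩ : ∃ b, b = M + 3 := ⟨_, rfl⟩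
  set A := P * ((X - C a) * (X - C b)) with hA
  set B := C (a - b) * Q with hB
  have hab : a - b = -1 := by rw [ha, hb]; ring
  have hcop : IsCoprime A B := by
    rw [hA, hB, hab]
    have hu : IsUnit (C (-1 : ℝ)) := isUnit_C.2 (by simp)
    refine (isCoprime_mul_unit_left_right hu _ _).2 ?_
    refine IsCoprime.mul_left hPQ (IsCoprime.mul_left ?_ ?_)
    · exact ((irreducible_X_sub_C a).coprime_iff_not_dvd).2 fun h =>
        hQne a (by linarith) (dvd_iff_isRoot.1 h)
    · exact ((irreducible_X_sub_C b).coprime_iff_not_dvd).2 fun h =>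
        hQne b (by linarith) (dvd_iff_isRoot.1 h)
  have hXX : ((X - C a) * (X - C b)).natDegree = 2 := by
    rw [natDegree_mul (X_sub_C_ne_zero a) (X_sub_C_ne_zero b)]; simp
  have hXXm : ((X - C a) * (X - C b)).Monic := (monic_X_sub_C a).mul (monic_X_sub_C b)
  have hAdeg : A.natDegree = Q.natDegree := by
    rw [hA, natDegree_mul hP hXXm.ne_zero, hXX, hdeg]
  -- In the pencil A + mB with A, B coprime, a multiple zero is a zero of the Wronskian, and each
  -- point is a zero for at most one m. So only finitely many m give a multiple real zero or a zero
  -- in G.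
  have hW : wronskian A B ≠ 0 := fun h => by
    have h1 := (hcop.wronskian_eq_zero_iff.1 h).1
    have := derivative_eq_zero.1 h1
    omega
  -- m < 2P/Q at the two test points keeps P₁Q positive there. The exclusions are the bad members of
  -- the pencil and the value m = lc(P)/lc(Q), at which the degree of P₁ drops.
  obtain ⟨m, hm0, hm, hmbad⟩ := exists_rat_pos_lt_notMem
    (δ := min ε
      (min (2 * (P.eval (M + 1) / Q.eval (M + 1))) (2 * (P.eval (M + 4) / Q.eval (M + 4)))))
    (by
      have h1 := hM (M + 1) (by linarith)
      have h4 := hM (M + 4) (by linarith)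
      refine lt_min hε (lt_min ?_ ?_) <;> refine mul_pos two_pos ?_
      · rcases pos_and_pos_or_neg_and_neg_of_mul_pos h1 with h | h
        · exact div_pos h.1 h.2
        · exact div_pos_of_neg_of_neg h.1 h.2
      · rcases pos_and_pos_or_neg_and_neg_of_mul_pos h4 with h | h
        · exact div_pos h.1 h.2
        · exact div_pos_of_neg_of_neg h.1 h.2)
    ((((wronskian A B).roots.toFinset.finite_toSet.union hG).image
      fun r => -A.eval r / B.eval r).union
      (Set.finite_singleton (P.leadingCoeff / Q.leadingCoeff)))
  have hm0' : (0 : ℝ) < m := by exact_mod_cast hm0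
  set P₁ := A + C ((m : ℝ) * (a - b)) * Q with hP₁
  have hP₁B : P₁ = A + C (m : ℝ) * B := by rw [hP₁, hB, C_mul, mul_assoc]
  have heval : ∀ t, P₁.eval t = P.eval t * ((t - a) * (t - b)) - m * Q.eval t := fun t => by
    rw [hP₁, hA, hab]; simp; ring
  have hlc : P₁.coeff Q.natDegree ≠ 0 := by
    have h1 : A.coeff Q.natDegree = P.leadingCoeff := by
      rw [← hAdeg, coeff_natDegree, hA, leadingCoeff_mul, hXXm.leadingCoeff, mul_one]
    rw [hP₁, coeff_add, h1, coeff_C_mul, coeff_natDegree, hab]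
    intro h
    apply hmbad
    right
    rw [Set.mem_singleton_iff, eq_div_iff (leadingCoeff_ne_zero.2 hQ)]
    linarith
  have hP₁deg : P₁.natDegree = Q.natDegree :=
    le_antisymm (natDegree_add_le_of_degree_le hAdeg.le (natDegree_C_mul_le _ _))
      (le_natDegree_of_ne_zero hlc)
  have hBne : ∀ t, P₁.eval t = 0 → B.eval t ≠ 0 := fun t ht hBt => by
    have hAt : A.eval t = 0 := by
      rw [hP₁B, eval_add, eval_mul (p := C (m : ℝ)), hBt, mul_zero, add_zero] at ht
      exact ht
    obtain ⟨u, v, huv⟩ := hcop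
    have := congrArg (eval t) huv
    simp [hAt, hBt] at this
  have hmeq : ∀ t, P₁.eval t = 0 → (m : ℝ) = -A.eval t / B.eval t := fun t ht => by
    have hBt := hBne t ht
    rw [hP₁B, eval_add, eval_mul (p := C (m : ℝ)), eval_C] at ht
    rw [eq_div_iff hBt]
    linarith
  have hnG : ∀ t, P₁.eval t = 0 → t ∉ G := fun t ht htG =>
    hmbad (Or.inl ⟨t, Or.inr htG, (hmeq t ht).symm⟩)
  have hder : ∀ t, P₁.eval t = 0 → P₁.derivative.eval t ≠ 0 := fun t ht hd => by
    refine hmbad (Or.inl ⟨t, Or.inl ?_, (hmeq t ht).symm⟩)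
    rw [Finset.mem_coe, Multiset.mem_toFinset, mem_roots hW, IsRoot, wronskian]
    rw [hP₁B] at ht hd
    simp only [derivative_add, derivative_mul, derivative_C, eval_add, eval_mul, eval_C, eval_sub,
      zero_mul, zero_add] at ht hd ⊢
    linear_combination B.derivative.eval t * ht - B.eval t * hd
  have hQt : ∀ t, P₁.eval t = 0 → Q.eval t ≠ 0 := fun t ht h =>
    hBne t ht (by rw [hB, eval_mul, h, mul_zero])
  have hPa : P₁.eval a ≠ 0 := by
    rw [heval]
    simp [hm0.ne', hQne a (by linarith)]
  have hPb : P₁.eval b ≠ 0 := by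
    rw [heval]
    simp [hm0.ne', hQne b (by linarith)]
  have hQ₁ : ∀ t, (Q * ((X - C a) * (X - C b))).eval t = Q.eval t * ((t - a) * (t - b)) :=
    fun t => by simp
  have hf : ∀ t, P₁.eval t = 0 →
      (P₁ * Q).derivative.eval t = P₁.derivative.eval t * Q.eval t := fun t ht => by
    simp [derivative_mul, ht]
  have hfs : ∀ t, M ≤ t → (P₁ * Q).eval t = 0 →
      P₁.eval t = 0 ∧ (P₁ * Q).derivative.eval t ≠ 0 := fun t htM ht => by
    rw [eval_mul] at ht
    have h0 := (mul_eq_zero.1 ht).resolve_right (hQne t htM)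
    exact ⟨h0, by rw [hf t h0]; exact mul_ne_zero (hder t h0) (hQt t h0)⟩
  have hend : ∀ x, M ≤ x → (m : ℝ) < 2 * (P.eval x / Q.eval x) → (x - a) * (x - b) = 2 →
      0 < (P₁ * Q).eval x := fun x hx hmx h2 => by
    rw [eval_mul, heval, h2]
    have hq := hQne x hx
    have hsq : 0 < Q.eval x ^ 2 := by positivity
    have h3 : P.eval x = P.eval x / Q.eval x * Q.eval x := by field_simp
    rw [h3]
    nlinarith
  have hmid : ∀ x, M ≤ x → (x - a) * (x - b) = 0 → (P₁ * Q).eval x < 0 := fun x hx h0 => by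
    rw [eval_mul, heval, h0]
    have hq := hQne x hx
    have hsq : 0 < Q.eval x ^ 2 := by positivity
    nlinarith
  -- P₁Q is positive at M + 1, negative at a and b, positive at M + 4: it has a zero of negative
  -- slope before a and one of positive slope after b. There (t - a)(t - b) > 0, so passing from Q
  -- to Q₁ does not change the sign.
  have hc0 := hend (M + 1) (by linarith)
    (lt_of_lt_of_le hm ((min_le_right _ _).trans (min_le_left _ _))) (by rw [ha, hb]; ring)
  have hc1 := hend (M + 4) (by linarith)
    (lt_of_lt_of_le hm ((min_le_right _ _).trans (min_le_right _ _))) (by rw [ha, hb]; ring)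
  have hfa := hmid a (by linarith) (by ring)
  have hfb := hmid b (by linarith) (by ring)
  refine ⟨a, b, m, P₁, _, by linarith [hab], fun h => ?_, fun h => ?_, hm0,
    lt_of_lt_of_le hm (min_le_left _ _), rfl, rfl, fun h => hlc (by rw [h, coeff_zero]), hP₁deg,
    hPa, hPb, hnG, fun t ht => ?_, ?_, ?_⟩
  · linarith [hMG a h]
  · linarith [hMG b h]
  · rw [hQ₁]
    refine mul_ne_zero (hder t ht) (mul_ne_zero (hQt t ht) (mul_ne_zero ?_ ?_)) <;>
      rw [sub_ne_zero] <;> rintro rfl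
    · exact hPa ht
    · exact hPb ht
  · obtain ⟨t, h1, h2, h3, h4⟩ := exists_root_derivative_pos (f := P₁ * Q) (by linarith) hfb hc1
      fun t h1 h2 h3 => (hfs t (by linarith) h3).2
    have h0 := (hfs t (by linarith) h3).1
    refine ⟨t, h0, ?_⟩
    rw [hf t h0] at h4
    rw [hQ₁, ← mul_assoc]
    exact mul_pos h4 (mul_pos (by linarith) (by linarith))
  · obtain ⟨t, h1, h2, h3, h4⟩ := exists_root_derivative_neg (f := P₁ * Q) (by linarith) hc0 hfa
      fun t h1 h2 h3 => (hfs t (by linarith) h3).2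
    have h0 := (hfs t (by linarith) h3).1
    refine ⟨t, h0, ?_⟩
    rw [hf t h0] at h4
    rw [hQ₁, ← mul_assoc]
    exact mul_neg_of_neg_of_pos h4 (mul_pos_of_neg_of_neg (by linarith) (by linarith))

/-- The dipole first, then poles at all the real zeros it leaves: the set is {a, b} ∪ T, and both
groups of residues have sum zero. The factor g stands for the common factor removed from the
original fraction; it enters only because the new poles must avoid its zeros. -/
theorem exists_balanced_residues_of_isCoprime {P Q g : ℝ[X]} (hg : g ≠ 0) (hPQ : IsCoprime P Q)
    (hdeg : P.natDegree + 2 = Q.natDegree) (hlead : 0 < P.leadingCoeff * Q.leadingCoeff)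
    {ε : ℝ} (hε : 0 < ε) :
    ∃ (S : Finset ℝ) (l : ℝ → ℚ), S.Nonempty ∧
      (∀ a ∈ S, (g * Q).eval a ≠ 0 ∧ l a ≠ 0 ∧ |(l a : ℝ)| < ε) ∧ ∑ a ∈ S, l a = 0 ∧
      (P * poleProd S + Q * polarNum S fun t => (l t : ℝ)).natDegree + 2
        = Q.natDegree + S.card ∧
      ∀ t, (P * poleProd S + Q * polarNum S fun t => (l t : ℝ)).eval t ≠ 0 := by
  classical
  have hQ : Q ≠ 0 := fun h => by simp [h] at hlead
  have hgQ : g * Q ≠ 0 := mul_ne_zero hg hQ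
  have hmemG : ∀ t, t ∈ ((g * Q).roots.toFinset : Set ℝ) ↔ (g * Q).eval t = 0 := fun t => by
    rw [Finset.mem_coe, Multiset.mem_toFinset, mem_roots hgQ, IsRoot]
  obtain ⟨a, b, m, P₁, Q₁, hab, haG, hbG, hm0, hmε, hP₁, hQ₁, hP₁0, hP₁deg, hPa, hPb, hnG, hs, hup,
    hdown⟩ := exists_dipole hPQ hdeg hlead (g * Q).roots.toFinset.finite_toSet hε
  have hQ₁deg : P₁.natDegree + 2 = Q₁.natDegree := by
    rw [hQ₁, natDegree_mul hQ (mul_ne_zero (X_sub_C_ne_zero a) (X_sub_C_ne_zero b)),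
      natDegree_mul (X_sub_C_ne_zero a) (X_sub_C_ne_zero b), hP₁deg]
    simp
  obtain ⟨w, hw, hwsum, hwdeg, hwne⟩ :=
    exists_residues_at_simple_roots hP₁0 hQ₁deg hs hup hdown hε
  set T := P₁.roots.toFinset with hT
  have hmemT : ∀ t, t ∈ T ↔ P₁.eval t = 0 := fun t => by simp [hT, hP₁0]
  have haT : a ∉ T := fun h => hPa ((hmemT a).1 h)
  have hbT : b ∉ T := fun h => hPb ((hmemT b).1 h)
  set l : ℝ → ℚ := fun t => if t = a then m else if t = b then -m else w t with hl
  have hla : l a = m := by simp [hl]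
  have hlb : l b = -m := by simp [hl, hab.symm]
  have hlT : ∀ t ∈ T, l t = w t := fun t ht => by
    have h1 : t ≠ a := fun h => haT (h ▸ ht)
    have h2 : t ≠ b := fun h => hbT (h ▸ ht)
    simp [hl, h1, h2]
  have hdisj : Disjoint ({a, b} : Finset ℝ) T := by
    rw [Finset.disjoint_left]
    intro t ht
    rcases Finset.mem_insert.1 ht with rfl | ht
    · exact haT
    · rw [Finset.mem_singleton.1 ht]; exact hbT
  have hpp : poleProd ({a, b} : Finset ℝ) = (X - C a) * (X - C b) := Finset.prod_pair hab
  have hpn : (polarNum ({a, b} : Finset ℝ) fun t => (l t : ℝ)) = C ((m : ℝ) * (a - b)) := by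
    have h1 : ({a, b} : Finset ℝ).erase a = {b} := by
      rw [Finset.erase_insert_eq_erase, Finset.erase_eq_of_notMem]
      simpa using hab
    have h2 : ({a, b} : Finset ℝ).erase b = {a} := by
      rw [Finset.pair_comm, Finset.erase_insert_eq_erase, Finset.erase_eq_of_notMem]
      simpa using hab.symm
    rw [polarNum, Finset.sum_pair hab, h1, h2, Finset.prod_singleton, Finset.prod_singleton, hla,
      hlb]
    simp only [Rat.cast_neg, C_neg, C_mul, C_sub]
    ring
  -- Adding the two groups of poles at once or one after the other gives the same numerator.
  have key : P * poleProd ({a, b} ∪ T) + Q * (polarNum ({a, b} ∪ T) fun t => (l t : ℝ))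
      = P₁ * poleProd T + Q₁ * polarNum T fun t => (w t : ℝ) := by
    rw [poleProd_union hdisj, polarNum_union hdisj, hpp, hpn, hP₁, hQ₁,
      polarNum_congr (c := fun t => (l t : ℝ)) (d := fun t => (w t : ℝ))
        fun t ht => by rw [hlT t ht]]
    ring
  refine ⟨{a, b} ∪ T, l, ⟨a, by simp⟩, fun t ht => ?_, ?_, ?_, ?_⟩
  · rcases Finset.mem_union.1 ht with ht | ht
    · rcases Finset.mem_insert.1 ht with rfl | ht
      · refine ⟨fun h => haG ((hmemG _).2 h), ?_, ?_⟩ <;> rw [hla]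
        · exact hm0.ne'
        · rwa [abs_of_pos (by exact_mod_cast hm0)]
      · rw [Finset.mem_singleton.1 ht]
        refine ⟨fun h => hbG ((hmemG _).2 h), ?_, ?_⟩ <;> rw [hlb]
        · exact (neg_lt_zero.2 hm0).ne
        · rw [Rat.cast_neg, abs_neg]
          rwa [abs_of_pos (by exact_mod_cast hm0)]
    · rw [hlT t ht]
      exact ⟨fun h => hnG t ((hmemT t).1 ht) ((hmemG _).2 h), hw t ht⟩
  · rw [Finset.sum_union hdisj, Finset.sum_pair hab, hla, hlb, Finset.sum_congr rfl hlT, hwsum]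
    ring
  · rw [key, hwdeg, Finset.card_union_of_disjoint hdisj, Finset.card_pair hab, hP₁deg]
    omega
  · rw [key]
    exact hwne

/-- Arbitrarily small balanced rational residues at real points remove the real zeros of
a real rational function `P / Q` with `deg P = deg Q - 2`, and keep the difference of degrees. -/
theorem exists_balanced_residues {P Q : ℝ[X]} (hP : P ≠ 0)
    (hdeg : P.natDegree + 2 = Q.natDegree) {ε : ℝ} (hε : 0 < ε) :
    ∃ (S : Finset ℝ) (l : ℝ → ℚ), S.Nonempty ∧
      (∀ a ∈ S, Q.eval a ≠ 0 ∧ l a ≠ 0 ∧ |(l a : ℝ)| < ε) ∧ ∑ a ∈ S, l a = 0 ∧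
      P * poleProd S + Q * (polarNum S fun t => (l t : ℝ)) ≠ 0 ∧
      (P * poleProd S + Q * polarNum S fun t => (l t : ℝ)).natDegree + 2
        = Q.natDegree + S.card ∧
      ∀ t, Q.eval t ≠ 0 → (P * poleProd S + Q * polarNum S fun t => (l t : ℝ)).eval t ≠ 0 := by
  classical
  have hQ : Q ≠ 0 := fun h => by simp [h] at hdeg
  obtain ⟨g, P₀, Q₀, hg, hP₀, hQ₀, hcop⟩ : ∃ g P₀ Q₀ : ℝ[X], g ≠ 0 ∧ P = g * P₀ ∧ Q = g * Q₀ ∧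
      IsCoprime P₀ Q₀ := by
    refine ⟨EuclideanDomain.gcd P Q, P / EuclideanDomain.gcd P Q, Q / EuclideanDomain.gcd P Q,
      fun h => hP (EuclideanDomain.gcd_eq_zero_iff.1 h).1, ?_, ?_, ?_⟩
    · exact (EuclideanDomain.mul_div_cancel' (fun h => hP (EuclideanDomain.gcd_eq_zero_iff.1 h).1)
        (EuclideanDomain.gcd_dvd_left _ _)).symm
    · exact (EuclideanDomain.mul_div_cancel' (fun h => hP (EuclideanDomain.gcd_eq_zero_iff.1 h).1)
        (EuclideanDomain.gcd_dvd_right _ _)).symm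
    · let := EuclideanDomain.gcdMonoid ℝ[X]
      exact _root_.isCoprime_div_gcd_div_gcd hQ
  have hP₀0 : P₀ ≠ 0 := fun h => hP (by rw [hP₀, h, mul_zero])
  have hQ₀0 : Q₀ ≠ 0 := fun h => hQ (by rw [hQ₀, h, mul_zero])
  have hdegQ : Q.natDegree = g.natDegree + Q₀.natDegree := by rw [hQ₀, natDegree_mul hg hQ₀0]
  have hdeg₀ : P₀.natDegree + 2 = Q₀.natDegree := by
    have hdegP : P.natDegree = g.natDegree + P₀.natDegree := by rw [hP₀, natDegree_mul hg hP₀0]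
    omega
  have main : ∃ (S : Finset ℝ) (l : ℝ → ℚ), S.Nonempty ∧
      (∀ a ∈ S, (g * Q₀).eval a ≠ 0 ∧ l a ≠ 0 ∧ |(l a : ℝ)| < ε) ∧ ∑ a ∈ S, l a = 0 ∧
      (P₀ * poleProd S + Q₀ * polarNum S fun t => (l t : ℝ)).natDegree + 2
        = Q₀.natDegree + S.card ∧
      ∀ t, (P₀ * poleProd S + Q₀ * polarNum S fun t => (l t : ℝ)).eval t ≠ 0 := by
    -- If P₀/Q₀ is negative near +∞, the result for -P₀ is used, with all residues negated.
    rcases lt_or_gt_of_ne (mul_ne_zero (leadingCoeff_ne_zero.2 hP₀0) (leadingCoeff_ne_zero.2 hQ₀0))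
      with hneg | hpos
    · obtain ⟨S, l, h1, h2, h3, h4, h5⟩ := exists_balanced_residues_of_isCoprime (P := -P₀) hg
        hcop.neg_left (by rwa [natDegree_neg]) (by rw [leadingCoeff_neg]; linarith) hε
      have key : P₀ * poleProd S + Q₀ * (polarNum S fun t => ((-l t : ℚ) : ℝ))
          = -(-P₀ * poleProd S + Q₀ * polarNum S fun t => (l t : ℝ)) := by
        have : (polarNum S fun t => ((-l t : ℚ) : ℝ)) = -polarNum S fun t => (l t : ℝ) := by
          rw [polarNum, polarNum, ← Finset.sum_neg_distrib]
          exact Finset.sum_congr rfl fun a _ => by rw [Rat.cast_neg, C_neg, neg_mul]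
        rw [this]
        ring
      refine ⟨S, fun t => -l t, h1, fun a ha => ⟨(h2 a ha).1, neg_ne_zero.2 (h2 a ha).2.1, ?_⟩,
        ?_, ?_, fun t => ?_⟩
      · rw [Rat.cast_neg, abs_neg]
        exact (h2 a ha).2.2
      · rw [Finset.sum_neg_distrib, h3, neg_zero]
      · rw [key, natDegree_neg, h4]
      · rw [key, eval_neg, neg_ne_zero]
        exact h5 t
    · exact exists_balanced_residues_of_isCoprime hg hcop hdeg₀ hpos hε
  obtain ⟨S, l, h1, h2, h3, h4, h5⟩ := main
  have key : P * poleProd S + Q * (polarNum S fun t => (l t : ℝ))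
      = g * (P₀ * poleProd S + Q₀ * polarNum S fun t => (l t : ℝ)) := by
    rw [hP₀, hQ₀]; ring
  have hne : (P₀ * poleProd S + Q₀ * polarNum S fun t => (l t : ℝ)) ≠ 0 := fun h =>
    h5 0 (by rw [h, eval_zero])
  refine ⟨S, l, h1, fun a ha => hQ₀ ▸ h2 a ha, h3, ?_, ?_, fun t ht => ?_⟩
  · rw [key]
    exact mul_ne_zero hg hne
  · rw [key, natDegree_mul hg hne]
    omega
  · rw [key, eval_mul]
    refine mul_ne_zero (fun h => ht ?_) (h5 t)
    rw [hQ₀, eval_mul, h, zero_mul]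

end RealLine

/-! ### Homogeneous components and leading forms of power series. -/

section HomPart

theorem degree_fin_two (d : Fin 2 →₀ ℕ) : d.degree = d 0 + d 1 := by
  rw [Finsupp.degree_eq_sum, Fin.sum_univ_two]

theorem single_add_single_fin_two (d : Fin 2 →₀ ℕ) :
    Finsupp.single 0 (d 0) + Finsupp.single 1 (d 1) = d := by
  ext k
  fin_cases k <;> simp

/-- The homogeneous component of degree `n` of a power series, as a polynomial. -/
def homPart (n : ℕ) (f : Ser) : MvPolynomial (Fin 2) ℂ :=
  ∑ p ∈ Finset.HasAntidiagonal.antidiagonal n,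
    MvPolynomial.monomial (Finsupp.single 0 p.1 + Finsupp.single 1 p.2)
      (MvPowerSeries.coeff (Finsupp.single 0 p.1 + Finsupp.single 1 p.2) f)

theorem initForm_eq_homPart (f : O) : initForm f = homPart (ord f) f := rfl

theorem coeff_homPart (n : ℕ) (f : Ser) (d : Fin 2 →₀ ℕ) :
    MvPolynomial.coeff d (homPart n f) = if d.degree = n then MvPowerSeries.coeff d f else 0 := by
  rw [homPart, MvPolynomial.coeff_sum, degree_fin_two]
  simp only [MvPolynomial.coeff_monomial]
  split_ifs with h
  · rw [Finset.sum_eq_single (d 0, d 1)]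
    · rw [if_pos (single_add_single_fin_two d), single_add_single_fin_two]
    · rintro ⟨i, j⟩ _ hne
      refine if_neg fun hd => hne ?_
      rw [← hd]
      simp
    · exact fun hn => absurd (Finset.HasAntidiagonal.mem_antidiagonal.2 h) hn
  · refine Finset.sum_eq_zero fun p hp => if_neg fun hd => h ?_
    rw [← hd, ← Finset.HasAntidiagonal.mem_antidiagonal.1 hp]
    simp

theorem coe_homPart (n : ℕ) (f : Ser) :
    (homPart n f : Ser) = MvPowerSeries.homogeneousComponent n f := by
  ext d
  rw [MvPolynomial.coeff_coe, coeff_homPart, MvPowerSeries.coeff_homogeneousComponent]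

/-- The degrees n and m only have to be lower bounds of the orders, so products can be treated even
when a leading form vanishes. -/
theorem homPart_mul {f g : Ser} {n m : ℕ} (hf : n ≤ f.order) (hg : m ≤ g.order) :
    homPart (n + m) (f * g) = homPart n f * homPart m g := by
  apply MvPolynomial.coe_injective
  rw [MvPolynomial.coe_mul, coe_homPart, coe_homPart, coe_homPart,
    MvPowerSeries.homogeneousComponent_mul_of_le_order hf hg]

theorem homPart_add (n : ℕ) (f g : Ser) : homPart n (f + g) = homPart n f + homPart n g := by
  apply MvPolynomial.coe_injective
  rw [MvPolynomial.coe_add, coe_homPart, coe_homPart, coe_homPart, map_add]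

theorem homPart_smul (n : ℕ) (c : ℂ) (f : Ser) :
    homPart n (c • f) = MvPolynomial.C c * homPart n f := by
  ext d
  rw [coeff_homPart, MvPolynomial.coeff_C_mul, coeff_homPart, MvPowerSeries.coeff_smul, mul_ite,
    mul_zero]

theorem homPart_sum {κ : Type*} (n : ℕ) (s : Finset κ) (f : κ → Ser) :
    homPart n (∑ i ∈ s, f i) = ∑ i ∈ s, homPart n (f i) := by
  apply MvPolynomial.coe_injective
  rw [coe_homPart, map_sum]
  refine Eq.trans ?_ (map_sum (MvPolynomial.coeToMvPowerSeries.ringHom) _ _).symm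
  exact Finset.sum_congr rfl fun i _ => (coe_homPart n (f i)).symm

theorem homPart_eq_zero {f : Ser} {n : ℕ} (h : n < f.order) : homPart n f = 0 := by
  apply MvPolynomial.coe_injective
  rw [coe_homPart, MvPowerSeries.homogeneousComponent_of_lt_order_eq_zero h, MvPolynomial.coe_zero]

theorem homPart_ne_zero {f : Ser} {n : ℕ} (h : n = f.order) : homPart n f ≠ 0 := fun h0 => by
  have := MvPowerSeries.homogeneousComponent_of_order h
  rw [← coe_homPart, h0, MvPolynomial.coe_zero] at this
  exact this rfl

theorem homPart_isHomogeneous (n : ℕ) (f : Ser) : (homPart n f).IsHomogeneous n := by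
  refine MvPolynomial.IsHomogeneous.sum _ _ _ fun p hp => ?_
  apply MvPolynomial.isHomogeneous_monomial
  rw [degree_fin_two, ← Finset.HasAntidiagonal.mem_antidiagonal.1 hp]
  simp

theorem lt_order_of_homPart_eq_zero {f : Ser} {n : ℕ} (hn : n ≤ f.order) (h : homPart n f = 0) :
    ((n + 1 : ℕ) : ℕ∞) ≤ f.order := by
  have hlt := lt_of_le_of_ne hn fun he => homPart_ne_zero he h
  rw [Nat.cast_add, Nat.cast_one]
  exact Order.add_one_le_of_lt hlt

theorem homPart_pderiv (n : ℕ) (k : Fin 2) (f : Ser) :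
    homPart n (MvPowerSeries.pderiv ℂ k f) = MvPolynomial.pderiv k (homPart (n + 1) f) := by
  ext d
  rw [coeff_homPart, ← MvPolynomial.coeff_coe (MvPolynomial.pderiv k (homPart (n + 1) f)),
    ← MvPowerSeries.pderiv_coe,
    MvPowerSeries.coeff_pderiv, MvPowerSeries.coeff_pderiv, MvPolynomial.coeff_coe, coeff_homPart]
  simp only [map_add, Finsupp.degree_single, Nat.add_right_cancel_iff]
  split_ifs <;> simp

theorem le_order_pderiv {n : ℕ} {f : Ser} (k : Fin 2) (h : ((n + 1 : ℕ) : ℕ∞) ≤ f.order) :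
    (n : ℕ∞) ≤ (MvPowerSeries.pderiv ℂ k f).order := by
  refine MvPowerSeries.nat_le_order fun d hd => ?_
  rw [MvPowerSeries.coeff_pderiv, MvPowerSeries.coeff_of_lt_order, zero_mul]
  refine lt_of_lt_of_le ?_ h
  rw [map_add, Finsupp.degree_single]
  exact_mod_cast Nat.succ_lt_succ hd

theorem homPart_prod {κ : Type*} (s : Finset κ) (f : κ → Ser) (n : κ → ℕ)
    (h : ∀ i ∈ s, (n i : ℕ∞) ≤ (f i).order) :
    homPart (∑ i ∈ s, n i) (∏ i ∈ s, f i) = ∏ i ∈ s, homPart (n i) (f i) ∧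
      ((∑ i ∈ s, n i : ℕ) : ℕ∞) ≤ (∏ i ∈ s, f i).order := by
  classical
  induction s using Finset.induction_on with
  | empty =>
    refine ⟨?_, by simp⟩
    ext d
    rw [coeff_homPart, Finset.prod_empty, Finset.prod_empty, Finset.sum_empty,
      ← MvPolynomial.coeff_coe, MvPolynomial.coe_one, MvPowerSeries.coeff_one]
    by_cases hd : d = 0
    · simp [hd]
    · simp [hd]
  | insert a s ha ih =>
    obtain ⟨ih1, ih2⟩ := ih fun i hi => h i (Finset.mem_insert_of_mem hi)
    have h1 := h a (Finset.mem_insert_self a s)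
    rw [Finset.prod_insert ha, Finset.prod_insert ha, Finset.sum_insert ha, homPart_mul h1 ih2, ih1]
    refine ⟨rfl, ?_⟩
    rw [MvPowerSeries.order_mul, Nat.cast_add]
    exact add_le_add h1 ih2

theorem order_eq_ord {f : O} (hf : f ≠ 0) : (f : Ser).order = ord f :=
  (MvPowerSeries.ne_zero_iff_order_finite.1 fun h => hf (Subtype.ext h)).symm

end HomPart

/-! ### Convergent series: derivatives, units, irreducibility in order one. -/

section Convergence

theorem Converges.smul {f : Ser} (c : ℂ) (hf : Converges f) : Converges (c • f) := by
  rw [MvPowerSeries.smul_eq_C_mul]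
  exact (converges_C c).mul hf

theorem Converges.pderiv {f : Ser} (k : Fin 2) (hf : Converges f) :
    Converges (MvPowerSeries.pderiv ℂ k f) := by
  obtain ⟨C, R, hC, hR, h⟩ := hf.good
  refine ⟨C * R, 2 * R, fun n => ?_⟩
  rw [MvPowerSeries.coeff_pderiv, norm_mul]
  have h1 := h (n + Finsupp.single k 1)
  have h2 : (n + Finsupp.single k 1 : Fin 2 →₀ ℕ) 0 + (n + Finsupp.single k 1 : Fin 2 →₀ ℕ) 1
      = n 0 + n 1 + 1 := by
    rw [← degree_fin_two, ← degree_fin_two, map_add, Finsupp.degree_single]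
  have h3 : ‖((n k : ℂ) + 1)‖ ≤ 2 ^ (n 0 + n 1) := by
    have h4 : n k + 1 ≤ 2 ^ (n 0 + n 1) := by
      have h5 : n k ≤ n 0 + n 1 := by fin_cases k <;> simp
      exact Nat.succ_le_of_lt (lt_of_le_of_lt h5 Nat.lt_two_pow_self)
    rw [← Nat.cast_add_one, Complex.norm_natCast]
    exact_mod_cast h4
  rw [h2] at h1
  calc _ ≤ C * R ^ (n 0 + n 1 + 1) * 2 ^ (n 0 + n 1) :=
        mul_le_mul h1 h3 (norm_nonneg _) (by positivity)
    _ = _ := by rw [mul_pow]; ring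

theorem sum_range_quarter_le (n : ℕ) : ∑ i ∈ Finset.range n, (1 / 4 : ℝ) ^ i ≤ 2 := by
  have h := geom_sum_eq (by norm_num : (1 / 4 : ℝ) ≠ 1) n
  have h0 : (0 : ℝ) ≤ (1 / 4) ^ n := by positivity
  rw [h, div_le_iff_of_neg (by norm_num)]
  linarith

theorem sum_antidiagonal_quarter_le (n : Fin 2 →₀ ℕ) :
    ∑ x ∈ Finset.HasAntidiagonal.antidiagonal n, (1 / 4 : ℝ) ^ (x.1 0 + x.1 1) ≤ 4 := by
  have hinj : Set.InjOn (fun x : (Fin 2 →₀ ℕ) × (Fin 2 →₀ ℕ) => (x.1 0, x.1 1))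
      (Finset.HasAntidiagonal.antidiagonal n : Finset _) := by
    intro p hp q hq hpq
    have hp' := Finset.HasAntidiagonal.mem_antidiagonal.1 hp
    have hq' := Finset.HasAntidiagonal.mem_antidiagonal.1 hq
    simp only [Prod.mk.injEq] at hpq
    have h1 : p.1 = q.1 := by
      ext k
      fin_cases k
      · exact hpq.1
      · exact hpq.2
    refine Prod.ext h1 ?_
    rw [h1] at hp'
    exact add_left_cancel (hp'.trans hq'.symm)
  calc _ = ∑ y ∈ (Finset.HasAntidiagonal.antidiagonal n).image
        (fun x : (Fin 2 →₀ ℕ) × (Fin 2 →₀ ℕ) => (x.1 0, x.1 1)), (1 / 4 : ℝ) ^ (y.1 + y.2) :=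
        (Finset.sum_image (f := fun y : ℕ × ℕ => (1 / 4 : ℝ) ^ (y.1 + y.2)) hinj).symm
    _ ≤ ∑ y ∈ Finset.range (n 0 + 1) ×ˢ Finset.range (n 1 + 1), (1 / 4 : ℝ) ^ (y.1 + y.2) := by
        refine Finset.sum_le_sum_of_subset_of_nonneg ?_ fun _ _ _ => by positivity
        intro y hy
        obtain ⟨x, hx, rfl⟩ := Finset.mem_image.1 hy
        have hx' := Finset.HasAntidiagonal.mem_antidiagonal.1 hx
        have h0 := DFunLike.congr_fun hx' 0
        have h1 := DFunLike.congr_fun hx' 1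
        simp only [Finsupp.add_apply] at h0 h1
        simp only [Finset.mem_product, Finset.mem_range]
        omega
    _ = (∑ i ∈ Finset.range (n 0 + 1), (1 / 4 : ℝ) ^ i) *
          ∑ j ∈ Finset.range (n 1 + 1), (1 / 4 : ℝ) ^ j := by
        rw [Finset.sum_mul_sum, Finset.sum_product]
        simp only [pow_add]
    _ ≤ 2 * 2 := mul_le_mul (sum_range_quarter_le _) (sum_range_quarter_le _)
        (Finset.sum_nonneg fun _ _ => by positivity) (by norm_num)
    _ = 4 := by norm_num

/-- Induction on the total degree along the recursion for the coefficients of the inverse. It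
identifies the units of `O` with the germs not vanishing at 0, so that poles have positive order and
order one implies irreducibility. -/
theorem Converges.invOfUnit {f : Ser} (hf : Converges f) (u : ℂˣ) :
    Converges (MvPowerSeries.invOfUnit f u) := by
  classical
  obtain ⟨C, R, hC, hR, h⟩ := hf.good
  set U := ‖((u⁻¹ : ℂˣ) : ℂ)‖ with hU
  have hU0 : 0 ≤ U := norm_nonneg _
  -- S ≥ 4R makes a term of the recursion decay like (1/4)^|x.1|; these weights sum to at most 4
  -- over the antidiagonal. S ≥ 16 U C R then absorbs the constants.
  set S : ℝ := 4 * R * (4 * (U * C) + 1) with hS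
  have hS4 : 4 * R ≤ S := by
    rw [hS]
    nlinarith [mul_nonneg hU0 hC]
  have hSpos : 0 < S := by linarith
  refine ⟨U, S, ?_⟩
  suffices ∀ N : ℕ, ∀ n : Fin 2 →₀ ℕ, n 0 + n 1 = N →
      ‖MvPowerSeries.coeff n (MvPowerSeries.invOfUnit f u)‖ ≤ U * S ^ (n 0 + n 1) from
    fun n => this _ n rfl
  intro N
  induction N using Nat.strong_induction_on with
  | _ N ih =>
    intro n hn
    rw [MvPowerSeries.coeff_invOfUnit]
    split_ifs with h0
    · rw [h0]; simp [hU]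
    rw [norm_mul, norm_neg, ← hU]
    refine mul_le_mul_of_nonneg_left ?_ hU0
    have hterm : ∀ x ∈ Finset.HasAntidiagonal.antidiagonal n,
        ‖(if x.2 < n then MvPowerSeries.coeff x.1 f *
          MvPowerSeries.coeff x.2 (MvPowerSeries.invOfUnit f u) else 0)‖
        ≤ (U * C * (4 * R) * S ^ (n 0 + n 1) / S) * (1 / 4 : ℝ) ^ (x.1 0 + x.1 1) := by
      intro x hx
      split_ifs with hlt
      · have hx' := Finset.HasAntidiagonal.mem_antidiagonal.1 hx
        have e0 := DFunLike.congr_fun hx' 0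
        have e1 := DFunLike.congr_fun hx' 1
        simp only [Finsupp.add_apply] at e0 e1
        have hpos : x.1 0 + x.1 1 ≠ 0 := fun hz => by
          have : x.1 = 0 := by
            ext k
            fin_cases k
            · simpa using (Nat.add_eq_zero_iff.1 hz).1
            · simpa using (Nat.add_eq_zero_iff.1 hz).2
          rw [this, zero_add] at hx'
          exact absurd hx' hlt.ne
        obtain ⟨k, hk⟩ := Nat.exists_eq_succ_of_ne_zero hpos
        have hih := ih (x.2 0 + x.2 1) (by omega) x.2 rfl
        have hsum : n 0 + n 1 = (x.2 0 + x.2 1) + (k + 1) := by omega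
        rw [norm_mul]
        calc _ ≤ (C * R ^ (x.1 0 + x.1 1)) * (U * S ^ (x.2 0 + x.2 1)) :=
              mul_le_mul (h _) hih (norm_nonneg _) (by positivity)
          _ = U * C * R * S ^ (x.2 0 + x.2 1) * R ^ k := by rw [hk, Nat.succ_eq_add_one]; ring
          _ ≤ U * C * R * S ^ (x.2 0 + x.2 1) * (S / 4) ^ k := by
              gcongr
              linarith
          _ = _ := by
              rw [hk, hsum, Nat.succ_eq_add_one, pow_add S (x.2 0 + x.2 1), pow_succ S, div_pow,
                one_div, inv_pow, pow_succ 4]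
              field_simp
      · rw [norm_zero]
        positivity
    refine (norm_sum_le _ _).trans ((Finset.sum_le_sum hterm).trans ?_)
    rw [← Finset.mul_sum]
    have hle : U * C * (4 * R) * 4 ≤ S := by
      rw [hS]
      nlinarith
    calc _ ≤ (U * C * (4 * R) * S ^ (n 0 + n 1) / S) * 4 :=
          mul_le_mul_of_nonneg_left (sum_antidiagonal_quarter_le n) (by positivity)
      _ = (U * C * (4 * R) * 4) * (S ^ (n 0 + n 1) / S) := by ring
      _ ≤ S * (S ^ (n 0 + n 1) / S) := by gcongr
      _ = S ^ (n 0 + n 1) := by field_simp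

theorem isUnit_iff_constantCoeff_ne_zero (f : O) :
    IsUnit f ↔ MvPowerSeries.constantCoeff (f : Ser) ≠ 0 := by
  constructor
  · intro h
    exact ((h.map O.subtype).map MvPowerSeries.constantCoeff).ne_zero
  · intro h
    have hmul := MvPowerSeries.mul_invOfUnit (f : Ser) (Units.mk0 _ h) rfl
    exact IsUnit.of_mul_eq_one ⟨_, f.2.invOfUnit (Units.mk0 _ h)⟩ (Subtype.ext hmul)

theorem one_le_ord_of_irreducible {f : O} (hf : Irreducible f) : 1 ≤ ord f := by
  have h : MvPowerSeries.constantCoeff (f : Ser) = 0 := by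
    by_contra h
    exact hf.not_isUnit ((isUnit_iff_constantCoeff_ne_zero f).2 h)
  have h1 := MvPowerSeries.one_le_order_iff_constCoeff_eq_zero.2 h
  rw [order_eq_ord hf.ne_zero] at h1
  exact_mod_cast h1

theorem irreducible_of_order_eq_one {f : O} (hf : (f : Ser).order = 1) : Irreducible f := by
  have h0 : MvPowerSeries.constantCoeff (f : Ser) = 0 :=
    MvPowerSeries.one_le_order_iff_constCoeff_eq_zero.1 hf.ge
  refine ⟨fun h => (isUnit_iff_constantCoeff_ne_zero f).1 h h0, fun {a b} hab => ?_⟩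
  by_contra! hn
  simp only [isUnit_iff_constantCoeff_ne_zero, not_not] at hn
  have h1 := MvPowerSeries.one_le_order_iff_constCoeff_eq_zero.2 hn.1
  have h2 := MvPowerSeries.one_le_order_iff_constCoeff_eq_zero.2 hn.2
  have h3 : (f : Ser) = (a : Ser) * (b : Ser) := congrArg Subtype.val hab
  rw [h3, MvPowerSeries.order_mul] at hf
  have h4 : (1 + 1 : ℕ∞) ≤ 1 := (add_le_add h1 h2).trans hf.le
  exact absurd h4 (by decide)

end Convergence

/-! ### The blow-up in a chart and transversality to the divisor. -/

section Pull

/-- The polynomial `t ↦ f (v + t w)`. -/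
def lineEval (v w : Fin 2 → ℂ) : MvPolynomial (Fin 2) ℂ →ₐ[ℂ] Polynomial ℂ :=
  MvPolynomial.aeval fun k => Polynomial.C (v k) + Polynomial.C (w k) * Polynomial.X

theorem lineEval_X (v w : Fin 2 → ℂ) (k : Fin 2) : lineEval v w (MvPolynomial.X k) =
    Polynomial.C (v k) + Polynomial.C (w k) * Polynomial.X :=
  MvPolynomial.aeval_X _ k

theorem lineEval_C (v w : Fin 2 → ℂ) (c : ℂ) :
    lineEval v w (MvPolynomial.C c) = Polynomial.C c :=
  MvPolynomial.aeval_C _ c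

theorem eval_lineEval (v w : Fin 2 → ℂ) (t : ℂ) (f : MvPolynomial (Fin 2) ℂ) :
    (lineEval v w f).eval t = MvPolynomial.eval (fun k => v k + w k * t) f := by
  rw [lineEval, MvPolynomial.aeval_def, MvPolynomial.eval₂_eq', MvPolynomial.eval_eq',
    Polynomial.eval_finsetSum]
  refine Finset.sum_congr rfl fun d _ => ?_
  rw [Polynomial.eval_mul, Polynomial.eval_prod]
  simp

theorem lineEval_homPart (v w : Fin 2 → ℂ) (n : ℕ) (f : Ser) :
    lineEval v w (homPart n f) = ∑ p ∈ Finset.HasAntidiagonal.antidiagonal n,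
      Polynomial.C (MvPowerSeries.coeff (Finsupp.single 0 p.1 + Finsupp.single 1 p.2) f) *
        ((Polynomial.C (v 0) + Polynomial.C (w 0) * Polynomial.X) ^ p.1 *
          (Polynomial.C (v 1) + Polynomial.C (w 1) * Polynomial.X) ^ p.2) := by
  rw [homPart, map_sum]
  refine Finset.sum_congr rfl fun p _ => ?_
  rw [lineEval, MvPolynomial.aeval_monomial, Finsupp.prod_fintype _ _ (by simp), Fin.prod_univ_two]
  simp [Polynomial.algebraMap_eq]

theorem coeff_X_pow_mul_aeval (n : ℕ) (q : Polynomial ℂ) (e : Fin 2 →₀ ℕ) :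
    MvPowerSeries.coeff e
      ((MvPowerSeries.X 0 : Ser) ^ n * Polynomial.aeval (MvPowerSeries.X 1 : Ser) q)
      = if e 0 = n then q.coeff (e 1) else 0 := by
  induction q using Polynomial.induction_on' with
  | add p q hp hq =>
    rw [map_add, mul_add, map_add, hp, hq, Polynomial.coeff_add]
    split_ifs <;> simp
  | monomial m a =>
    rw [Polynomial.aeval_monomial, MvPowerSeries.algebraMap_apply, Algebra.algebraMap_self,
      RingHom.id_apply, MvPowerSeries.X_pow_eq, MvPowerSeries.X_pow_eq, mul_left_comm,
      MvPowerSeries.monomial_mul_monomial, mul_one, MvPowerSeries.coeff_C_mul,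
      MvPowerSeries.coeff_monomial, Polynomial.coeff_monomial]
    have : e = Finsupp.single 0 n + Finsupp.single 1 m ↔ e 0 = n ∧ m = e 1 := by
      constructor
      · intro h
        rw [h]
        simp
      · rintro ⟨rfl, rfl⟩
        exact (single_add_single_fin_two e).symm
    simp only [this]
    by_cases h0 : e 0 = n <;> by_cases h1 : m = e 1 <;> simp [h0, h1]

theorem chartDir_eq_aeval (v w : Fin 2 → ℂ) (k : Fin 2) :
    chartDir v w k = Polynomial.aeval (MvPowerSeries.X 1 : Ser)
      (Polynomial.C (v k) + Polynomial.C (w k) * Polynomial.X) := by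
  rw [chartDir, map_add, map_mul, Polynomial.aeval_C, Polynomial.aeval_C, Polynomial.aeval_X]
  rfl

theorem hasSubst_chart (v w : Fin 2 → ℂ) :
    MvPowerSeries.HasSubst (fun k : Fin 2 => (MvPowerSeries.X 0 : Ser) * chartDir v w k) :=
  MvPowerSeries.hasSubst_of_constantCoeff_zero fun k => by simp

/-- f(x(v + sw)) = ∑ xⁿ fₙ(v + sw), with fₙ the homogeneous component of degree n; the sum over
monomials is finite in each degree. -/
theorem coeff_pull (v w : Fin 2 → ℂ) (f : Ser) (e : Fin 2 →₀ ℕ) :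
    MvPowerSeries.coeff e (pull v w f) = (lineEval v w (homPart (e 0) f)).coeff (e 1) := by
  classical
  have hprod : ∀ d : Fin 2 →₀ ℕ, MvPowerSeries.coeff e
      (d.prod fun s k => ((MvPowerSeries.X 0 : Ser) * chartDir v w s) ^ k)
      = if e 0 = d 0 + d 1 then ((Polynomial.C (v 0) + Polynomial.C (w 0) * Polynomial.X) ^ d 0 *
          (Polynomial.C (v 1) + Polynomial.C (w 1) * Polynomial.X) ^ d 1).coeff (e 1) else 0 := by
    intro d
    rw [← coeff_X_pow_mul_aeval, Finsupp.prod_fintype _ _ (by simp), Fin.prod_univ_two,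
      map_mul (Polynomial.aeval _), map_pow (Polynomial.aeval _), map_pow (Polynomial.aeval _),
      ← chartDir_eq_aeval, ← chartDir_eq_aeval]
    rw [mul_pow, mul_pow, pow_add, mul_mul_mul_comm]
  have hinj : Set.InjOn
      (fun p : ℕ × ℕ => (Finsupp.single 0 p.1 + Finsupp.single 1 p.2 : Fin 2 →₀ ℕ))
      (Finset.HasAntidiagonal.antidiagonal (e 0) : Finset (ℕ × ℕ)) := by
    rintro ⟨i, j⟩ _ ⟨i', j'⟩ _ h
    have h0 := DFunLike.congr_fun h 0
    have h1 := DFunLike.congr_fun h 1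
    simp at h0 h1
    rw [h0, h1]
  rw [pull, MvPowerSeries.coeff_subst (hasSubst_chart v w),
    finsum_eq_finsetSum_of_support_subset (s := (Finset.HasAntidiagonal.antidiagonal (e 0)).image
      fun p : ℕ × ℕ => (Finsupp.single 0 p.1 + Finsupp.single 1 p.2 : Fin 2 →₀ ℕ)),
    Finset.sum_image hinj, lineEval_homPart, Polynomial.finsetSum_coeff]
  · refine Finset.sum_congr rfl fun p hp => ?_
    have hp' := Finset.HasAntidiagonal.mem_antidiagonal.1 hp
    rw [hprod, Polynomial.coeff_C_mul]
    simp [hp']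
  · intro d hd
    have hd' : e 0 = d 0 + d 1 := by
      by_contra hne
      rw [Function.mem_support, hprod, if_neg hne, smul_zero] at hd
      exact hd rfl
    rw [Finset.mem_coe, Finset.mem_image]
    exact ⟨(d 0, d 1), Finset.HasAntidiagonal.mem_antidiagonal.2 hd'.symm,
      single_add_single_fin_two d⟩

theorem coeff_pull_single (v w : Fin 2 → ℂ) (f : Ser) (n : ℕ) :
    MvPowerSeries.coeff (Finsupp.single 0 n) (pull v w f) = MvPolynomial.eval v (homPart n f) := by
  rw [coeff_pull]
  simp [Polynomial.coeff_zero_eq_eval_zero, eval_lineEval]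

theorem X_pow_dvd_pull (v w : Fin 2 → ℂ) {f : Ser} {n : ℕ} (h : n ≤ f.order) :
    (MvPowerSeries.X 0 : Ser) ^ n ∣ pull v w f := by
  refine MvPowerSeries.X_pow_dvd_iff.2 fun e he => ?_
  rw [coeff_pull, homPart_eq_zero (lt_of_lt_of_le (by exact_mod_cast he) h), map_zero,
    Polynomial.coeff_zero]

theorem norm_coeff_linear_mul_le (c d : ℂ) {q : Polynomial ℂ} {B : ℝ}
    (h : ∀ m, ‖q.coeff m‖ ≤ B) (m : ℕ) :
    ‖((Polynomial.C c + Polynomial.C d * Polynomial.X) * q).coeff m‖ ≤ (‖c‖ + ‖d‖) * B := by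
  have hB : 0 ≤ B := (norm_nonneg _).trans (h 0)
  rw [add_mul, Polynomial.coeff_add, Polynomial.coeff_C_mul, mul_assoc, Polynomial.coeff_C_mul,
    add_mul]
  refine (norm_add_le _ _).trans (add_le_add ?_ ?_)
  · rw [norm_mul]
    exact mul_le_mul_of_nonneg_left (h m) (norm_nonneg _)
  · rw [norm_mul]
    refine mul_le_mul_of_nonneg_left ?_ (norm_nonneg _)
    cases m with
    | zero => simpa using hB
    | succ m => rw [Polynomial.coeff_X_mul]; exact h m

theorem norm_coeff_linear_pow_mul_le (c d : ℂ) {q : Polynomial ℂ} {B : ℝ}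
    (h : ∀ m, ‖q.coeff m‖ ≤ B) (i m : ℕ) :
    ‖((Polynomial.C c + Polynomial.C d * Polynomial.X) ^ i * q).coeff m‖
      ≤ (‖c‖ + ‖d‖) ^ i * B := by
  induction i generalizing m with
  | zero => simpa using h m
  | succ i ih =>
    rw [pow_succ', mul_assoc, pow_succ', mul_assoc]
    exact norm_coeff_linear_mul_le c d ih m

theorem Converges.pull {f : Ser} (hf : Converges f) (v w : Fin 2 → ℂ) :
    Converges (pull v w f) := by
  obtain ⟨C, R, hC, hR, h⟩ := hf.good
  set K : ℝ := 1 + (‖v 0‖ + ‖w 0‖) + (‖v 1‖ + ‖w 1‖) with hK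
  have hK1 : 1 ≤ K := by
    have := norm_nonneg (v 0)
    have := norm_nonneg (w 0)
    have := norm_nonneg (v 1)
    have := norm_nonneg (w 1)
    linarith
  refine ⟨C, 2 * (R * K), fun e => ?_⟩
  rw [coeff_pull, lineEval_homPart, Polynomial.finsetSum_coeff]
  have hterm : ∀ p ∈ Finset.HasAntidiagonal.antidiagonal (e 0),
      ‖(Polynomial.C (MvPowerSeries.coeff (Finsupp.single 0 p.1 + Finsupp.single 1 p.2) f) *
        ((Polynomial.C (v 0) + Polynomial.C (w 0) * Polynomial.X) ^ p.1 *
          (Polynomial.C (v 1) + Polynomial.C (w 1) * Polynomial.X) ^ p.2)).coeff (e 1)‖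
      ≤ C * (R * K) ^ e 0 := by
    intro p hp
    have hp' := Finset.HasAntidiagonal.mem_antidiagonal.1 hp
    have h1 : ∀ m, ‖(1 : Polynomial ℂ).coeff m‖ ≤ 1 := fun m => by
      rw [Polynomial.coeff_one]
      split_ifs <;> simp
    have h2 := norm_coeff_linear_pow_mul_le (v 0) (w 0)
      (norm_coeff_linear_pow_mul_le (v 1) (w 1) h1 p.2) p.1 (e 1)
    rw [mul_one, mul_one] at h2
    have h3 := h (Finsupp.single 0 p.1 + Finsupp.single 1 p.2)
    simp at h3
    rw [Polynomial.coeff_C_mul, norm_mul, mul_pow, ← mul_assoc]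
    refine mul_le_mul ?_ (h2.trans ?_) (norm_nonneg _) (by positivity)
    · rw [← hp']
      exact h3
    · rw [← hp', pow_add]
      have := norm_nonneg (v 0)
      have := norm_nonneg (w 0)
      have := norm_nonneg (v 1)
      have := norm_nonneg (w 1)
      gcongr <;> linarith
  refine (norm_sum_le _ _).trans ((Finset.sum_le_card_nsmul _ _ _ hterm).trans ?_)
  rw [nsmul_eq_mul, Finset.Nat.card_antidiagonal]
  have hRK : 1 ≤ R * K := by nlinarith
  have h4 : ((e 0 + 1 : ℕ) : ℝ) ≤ 2 ^ e 0 := by exact_mod_cast Nat.succ_le_of_lt Nat.lt_two_pow_self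
  calc _ ≤ 2 ^ e 0 * (C * (R * K) ^ e 0) := by gcongr
    _ = C * (2 * (R * K)) ^ e 0 := by rw [mul_pow 2, mul_left_comm]
    _ ≤ C * (2 * (R * K)) ^ (e 0 + e 1) := by
      gcongr
      · linarith
      · omega

theorem converges_X (k : Fin 2) : Converges (MvPowerSeries.X k) := by
  classical
  refine ⟨1, 1, fun n => ?_⟩
  rw [MvPowerSeries.coeff_X]
  split_ifs <;> simp

theorem converges_chartDir (v w : Fin 2 → ℂ) (k : Fin 2) : Converges (chartDir v w k) :=
  (converges_C _).add ((converges_C _).mul (converges_X 1))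

/-- Division by a power of x only shifts the coefficients, so the geometric bound survives and the
quotient stays in `O`. -/
theorem Converges.exists_eq_X_pow_mul {A : Ser} (hA : Converges A) {n : ℕ}
    (h : (MvPowerSeries.X 0 : Ser) ^ n ∣ A) :
    ∃ u : O, A = (MvPowerSeries.X 0 : Ser) ^ n * u ∧
      MvPowerSeries.constantCoeff (u : Ser) = MvPowerSeries.coeff (Finsupp.single 0 n) A := by
  obtain ⟨u, hu⟩ := h
  have hcoeff : ∀ d, MvPowerSeries.coeff d u = MvPowerSeries.coeff (Finsupp.single 0 n + d) A :=
    fun d => by rw [hu, MvPowerSeries.X_pow_eq, MvPowerSeries.coeff_add_monomial_mul, one_mul]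
  obtain ⟨C, R, hC, hR, hb⟩ := hA.good
  refine ⟨⟨u, C * R ^ n, R, fun d => ?_⟩, hu, ?_⟩
  · rw [hcoeff]
    refine (hb _).trans (le_of_eq ?_)
    simp only [Finsupp.add_apply, Finsupp.single_eq_same, ne_eq, one_ne_zero, not_false_eq_true,
      Finsupp.single_eq_of_ne, zero_add]
    rw [add_assoc, pow_add, mul_assoc]
  · rw [← MvPowerSeries.coeff_zero_eq_constantCoeff_apply]
    exact (hcoeff 0).trans (by rw [add_zero])

/-- If the radial part of `A dx + B dy` vanishes to higher order and the leading part of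
`A dx + B dy` is nonzero on `w` at `v`, then the blown up foliation is transversal to the divisor
at `[v]`. -/
theorem transversalToDivisor_pull {A B : Ser} (hA : Converges A) (hB : Converges B) {n : ℕ}
    (hnA : n ≤ A.order) (hnB : n ≤ B.order)
    (hrad : ((n + 2 : ℕ) : ℕ∞) ≤ (A * MvPowerSeries.X 0 + B * MvPowerSeries.X 1).order)
    {v w : Fin 2 → ℂ}
    (hne : w 0 * MvPolynomial.eval v (homPart n A) + w 1 * MvPolynomial.eval v (homPart n B) ≠ 0) :
    TransversalToDivisor (pull v w A * chartDir v w 0 + pull v w B * chartDir v w 1)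
      (MvPowerSeries.X 0 *
        (MvPowerSeries.C (w 0) * pull v w A + MvPowerSeries.C (w 1) * pull v w B)) := by
  have hX0 : (MvPowerSeries.X 0 : Ser) ≠ 0 := fun h => by
    have h' := congrArg (MvPowerSeries.coeff (Finsupp.single 0 1)) h
    rw [MvPowerSeries.coeff_index_single_self_X, map_zero] at h'
    exact one_ne_zero h'
  have hs := hasSubst_chart v w
  -- The radial part Ax + By pulls back to x times the coefficient of dx; one of its n + 2 factors x
  -- is used up here.
  have h1 : (MvPowerSeries.X 0 : Ser) ^ (n + 1) ∣
      pull v w A * chartDir v w 0 + pull v w B * chartDir v w 1 := by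
    have h2 := X_pow_dvd_pull v w hrad
    have h3 : pull v w (A * MvPowerSeries.X 0 + B * MvPowerSeries.X 1)
        = MvPowerSeries.X 0 * (pull v w A * chartDir v w 0 + pull v w B * chartDir v w 1) := by
      simp only [pull, MvPowerSeries.subst_add hs, MvPowerSeries.subst_mul hs,
        MvPowerSeries.subst_X hs]
      ring
    rw [h3, pow_succ'] at h2
    exact (mul_dvd_mul_iff_left hX0).1 h2
  have h4 : (MvPowerSeries.X 0 : Ser) ^ n ∣
      MvPowerSeries.C (w 0) * pull v w A + MvPowerSeries.C (w 1) * pull v w B :=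
    dvd_add ((X_pow_dvd_pull v w hnA).mul_left _) ((X_pow_dvd_pull v w hnB).mul_left _)
  have hcA := hA.pull v w
  have hcB := hB.pull v w
  obtain ⟨u, hu, -⟩ := Converges.exists_eq_X_pow_mul
    ((hcA.mul (converges_chartDir v w 0)).add (hcB.mul (converges_chartDir v w 1))) h1
  obtain ⟨u', hu', hc⟩ := Converges.exists_eq_X_pow_mul
    (((converges_C (w 0)).mul hcA).add ((converges_C (w 1)).mul hcB)) h4
  obtain ⟨x, hx⟩ : ∃ x : O, (x : Ser) = MvPowerSeries.X 0 := ⟨⟨_, converges_X 0⟩, rfl⟩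
  -- After removing x^(n+1), the coefficient of ds takes at the origin the value on w of the leading
  -- form at v.
  refine ⟨x ^ (n + 1), u, u', ?_, ?_, ?_, ?_⟩
  · refine pow_ne_zero _ fun h => hX0 ?_
    rw [← hx, h, ZeroMemClass.coe_zero]
  · rw [Subring.coe_mul, SubmonoidClass.coe_pow, hx, hu]
  · rw [Subring.coe_mul, SubmonoidClass.coe_pow, hx, hu', ← mul_assoc, ← pow_succ']
  · rw [hc, map_add, MvPowerSeries.coeff_C_mul, MvPowerSeries.coeff_C_mul, coeff_pull_single,
      coeff_pull_single]
    exact hne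

end Pull

/-! ### Homogeneous polynomials restricted to an affine line. -/

section LineEval

theorem derivative_lineEval (v w : Fin 2 → ℂ) (F : MvPolynomial (Fin 2) ℂ) :
    derivative (lineEval v w F) = C (w 0) * lineEval v w (MvPolynomial.pderiv 0 F) +
      C (w 1) * lineEval v w (MvPolynomial.pderiv 1 F) := by
  induction F using MvPolynomial.induction_on with
  | C a => simp
  | add p q hp hq =>
    simp only [map_add, hp, hq]
    ring
  | mul_X p k hp =>
    rw [map_mul, derivative_mul, hp, MvPolynomial.pderiv_mul, MvPolynomial.pderiv_mul, lineEval_X]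
    simp only [map_add, map_mul, lineEval_X, derivative_C, derivative_mul, derivative_X]
    fin_cases k
    · simp
      ring
    · simp
      ring

theorem natDegree_linear_pow_le (c d : ℂ) (i : ℕ) : ((C c + C d * X) ^ i).natDegree ≤ i := by
  refine natDegree_pow_le.trans ?_
  have : (C c + C d * X).natDegree ≤ 1 := by compute_degree
  nlinarith

theorem coeff_linear_pow (c d : ℂ) (i : ℕ) : ((C c + C d * X) ^ i).coeff i = d ^ i := by
  have h : (C c + C d * X).natDegree ≤ 1 := by compute_degree
  have := coeff_pow_of_natDegree_le (m := i) h
  rw [mul_one] at this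
  rw [this]
  simp

theorem natDegree_lineEval_le {F : MvPolynomial (Fin 2) ℂ} {n : ℕ} (hF : F.IsHomogeneous n)
    (v w : Fin 2 → ℂ) : (lineEval v w F).natDegree ≤ n := by
  rw [lineEval, MvPolynomial.aeval_def, MvPolynomial.eval₂_eq']
  refine natDegree_sum_le_of_forall_le _ _ fun d hd => ?_
  rw [Polynomial.algebraMap_eq, Fin.prod_univ_two]
  refine (natDegree_C_mul_le _ _).trans (natDegree_mul_le.trans ?_)
  have h : n = d.degree := hF.degree_eq_sum_deg_support hd
  have h0 := natDegree_linear_pow_le (v 0) (w 0) (d 0)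
  have h1 := natDegree_linear_pow_le (v 1) (w 1) (d 1)
  rw [degree_fin_two] at h
  omega

/-- The coefficient of degree n in t of F(v + tw) is the value of F at the point at infinity w of
the line. -/
theorem coeff_lineEval {F : MvPolynomial (Fin 2) ℂ} {n : ℕ} (hF : F.IsHomogeneous n)
    (v w : Fin 2 → ℂ) : (lineEval v w F).coeff n = MvPolynomial.eval w F := by
  rw [lineEval, MvPolynomial.aeval_def, MvPolynomial.eval₂_eq', MvPolynomial.eval_eq',
    finsetSum_coeff]
  refine Finset.sum_congr rfl fun d hd => ?_
  have h : n = d.degree := hF.degree_eq_sum_deg_support hd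
  rw [degree_fin_two] at h
  rw [Polynomial.algebraMap_eq, Fin.prod_univ_two, Fin.prod_univ_two, coeff_C_mul, h,
    coeff_mul_add_eq_of_natDegree_le (natDegree_linear_pow_le _ _ _)
      (natDegree_linear_pow_le _ _ _), coeff_linear_pow, coeff_linear_pow]

theorem eval_smul_of_isHomogeneous {F : MvPolynomial (Fin 2) ℂ} {n : ℕ} (hF : F.IsHomogeneous n)
    (c : ℂ) (v : Fin 2 → ℂ) :
    MvPolynomial.eval (fun k => c * v k) F = c ^ n * MvPolynomial.eval v F := by
  rw [MvPolynomial.eval_eq', MvPolynomial.eval_eq', Finset.mul_sum]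
  refine Finset.sum_congr rfl fun d hd => ?_
  have h : n = d.degree := hF.degree_eq_sum_deg_support hd
  rw [degree_fin_two] at h
  rw [Fin.prod_univ_two, Fin.prod_univ_two, h, mul_pow, mul_pow, pow_add]
  ring

end LineEval

/-! ### Logarithmic derivatives of polynomials, with denominators cleared. -/

section LogDerivative

variable {K : Type*} [Field K] [DecidableEq K]

theorem derivative_prod_X_sub_C_pow_mul_poleProd (S : Finset K) (m : K → ℕ) :
    derivative (∏ a ∈ S, (X - C a) ^ m a) * poleProd S =
      (∏ a ∈ S, (X - C a) ^ m a) * polarNum S fun a => (m a : K) := by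
  induction S using Finset.induction_on with
  | empty => simp [polarNum]
  | insert a S ha ih =>
    have hd : Disjoint {a} S := Finset.disjoint_singleton_left.2 ha
    have h1 : poleProd {a} = X - C a := Finset.prod_singleton _ _
    have h2 : polarNum {a} (fun a => (m a : K)) = C (m a : K) := by simp [polarNum]
    rw [Finset.prod_insert ha, Finset.insert_eq, poleProd_union hd, polarNum_union hd, h1, h2,
      derivative_mul, derivative_X_sub_C_pow]
    have h3 : C (m a : K) * (X - C a) ^ (m a - 1) * (X - C a) = C (m a : K) * (X - C a) ^ m a := by
      cases m a with
      | zero => simp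
      | succ k => rw [Nat.add_sub_cancel, mul_assoc, ← pow_succ]
    linear_combination (∏ a ∈ S, (X - C a) ^ m a) * poleProd S * h3 +
      (X - C a) ^ m a * (X - C a) * ih

/-- S may contain points which are not roots: they carry multiplicity 0. This lets one denominator,
the whole cone, serve for all the poles of the form. -/
theorem derivative_mul_poleProd {p : ℂ[X]} (hp : p ≠ 0) {S : Finset ℂ}
    (hS : ∀ a, p.IsRoot a → a ∈ S) :
    derivative p * poleProd S = p * polarNum S fun a => (p.rootMultiplicity a : ℂ) := by
  have hprod : p = C p.leadingCoeff * ∏ a ∈ S, (X - C a) ^ p.rootMultiplicity a := by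
    conv_lhs => rw [(IsAlgClosed.splits p).eq_prod_roots]
    rw [prod_multiset_root_eq_finset_root]
    congr 1
    refine Finset.prod_subset (fun a ha => hS a ?_) fun a _ ha => ?_
    · exact isRoot_of_mem_roots (Multiset.mem_toFinset.1 ha)
    · rw [Multiset.mem_toFinset, mem_roots hp] at ha
      rw [rootMultiplicity_eq_zero ha, pow_zero]
  have h := derivative_prod_X_sub_C_pow_mul_poleProd S fun a => p.rootMultiplicity a
  have h1 : derivative p = C p.leadingCoeff *
      derivative (∏ a ∈ S, (X - C a) ^ p.rootMultiplicity a) := by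
    rw [← derivative_C_mul, ← hprod]
  rw [h1, mul_assoc, h, ← mul_assoc, ← hprod]

end LogDerivative

/-! ### The leading form of `f η` and escape points. -/

namespace LogForm

variable {ι : Type*}

theorem order_f {η : LogForm ι} (i : ι) : (η.f i : Ser).order = ord (η.f i) :=
  order_eq_ord (η.irreducible i).ne_zero

variable [Fintype ι] (η : LogForm ι)

/-- The order of the product of the equations of the poles. -/
def totalOrd : ℕ := ∑ i, ord (η.f i)

/-- The leading form of the `k`-th coefficient of `f η`. -/
def leadForm (k : Fin 2) : MvPolynomial (Fin 2) ℂ :=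
  open Classical in
  ∑ i, MvPolynomial.C (η.res i) * ((∏ j ∈ Finset.univ.erase i, initForm (η.f j)) *
    MvPolynomial.pderiv k (initForm (η.f i)))

variable {η}

theorem order_F : η.F.order = η.totalOrd := by
  rw [F, MvPowerSeries.order_prod, totalOrd, Nat.cast_sum]
  exact Finset.sum_congr rfl fun i _ => order_f i

theorem polarPart_lead {N : ℕ} (hN : η.totalOrd = N + 1) (k : Fin 2) :
    homPart N (η.polarPart k) = η.leadForm k ∧ (N : ℕ∞) ≤ (η.polarPart k).order := by
  classical
  have hterm : ∀ i, homPart N (η.res i • ((∏ j ∈ Finset.univ.erase i, (η.f j : Ser)) *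
      MvPowerSeries.pderiv ℂ k (η.f i : Ser))) = MvPolynomial.C (η.res i) *
        ((∏ j ∈ Finset.univ.erase i, initForm (η.f j)) *
          MvPolynomial.pderiv k (initForm (η.f i))) ∧
      (N : ℕ∞) ≤ (η.res i • ((∏ j ∈ Finset.univ.erase i, (η.f j : Ser)) *
      MvPowerSeries.pderiv ℂ k (η.f i : Ser))).order := by
    intro i
    obtain ⟨m, hm⟩ := Nat.exists_eq_add_of_le' (one_le_ord_of_irreducible (η.irreducible i))
    have h1 : ∑ j ∈ Finset.univ.erase i, ord (η.f j) + m = N := by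
      have := Finset.sum_erase_add Finset.univ (fun j => ord (η.f j)) (Finset.mem_univ i)
      rw [totalOrd] at hN
      omega
    obtain ⟨h2, h3⟩ := homPart_prod (Finset.univ.erase i) (fun j => (η.f j : Ser))
      (fun j => ord (η.f j)) fun j _ => (order_f j).ge
    have h4 : (m : ℕ∞) ≤ (MvPowerSeries.pderiv ℂ k (η.f i : Ser)).order :=
      le_order_pderiv k (by rw [order_f, hm])
    refine ⟨?_, ?_⟩
    · rw [homPart_smul, ← h1, homPart_mul h3 h4, h2, homPart_pderiv, ← hm]
      rfl
    · refine le_trans ?_ MvPowerSeries.le_order_smul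
      rw [MvPowerSeries.order_mul, ← h1, Nat.cast_add]
      exact add_le_add h3 h4
  refine ⟨?_, ?_⟩
  · rw [polarPart, homPart_sum, leadForm]
    exact Finset.sum_congr rfl fun i _ => (hterm i).1
  · rw [polarPart]
    refine Finset.sum_induction _ (fun f : Ser => (N : ℕ∞) ≤ f.order) (fun a b ha hb => ?_) ?_
      fun i _ => (hterm i).2
    · exact (le_min ha hb).trans MvPowerSeries.min_order_le_add
    · simp

theorem lead_add_F_mul {N : ℕ} (hN : η.totalOrd = N + 1) (k : Fin 2) (g : Ser) :
    homPart N (η.polarPart k + η.F * g) = η.leadForm k ∧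
      (N : ℕ∞) ≤ (η.polarPart k + η.F * g).order := by
  obtain ⟨h1, h2⟩ := polarPart_lead hN k
  -- The holomorphic part is multiplied by f, of order N + 1, so it does not reach degree N.
  have h3 : ((N + 1 : ℕ) : ℕ∞) ≤ (η.F * g).order := by
    rw [MvPowerSeries.order_mul, order_F, hN]
    exact le_self_add
  have h4 : (N : ℕ∞) < (η.F * g).order := lt_of_lt_of_le (by exact_mod_cast Nat.lt_succ_self N) h3
  refine ⟨?_, (le_min h2 h4.le).trans MvPowerSeries.min_order_le_add⟩
  rw [homPart_add, h1, homPart_eq_zero h4, add_zero]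

theorem ωx_lead {N : ℕ} (hN : η.totalOrd = N + 1) :
    homPart N η.ωx = η.leadForm 0 ∧ (N : ℕ∞) ≤ η.ωx.order :=
  lead_add_F_mul hN 0 _

theorem ωy_lead {N : ℕ} (hN : η.totalOrd = N + 1) :
    homPart N η.ωy = η.leadForm 1 ∧ (N : ℕ∞) ≤ η.ωy.order :=
  lead_add_F_mul hN 1 _

theorem converges_polarPart_add (k : Fin 2) (g : O) :
    Converges (η.polarPart k + η.F * (g : Ser)) := by
  classical
  have hprod : ∀ s : Finset ι, Converges (∏ j ∈ s, (η.f j : Ser)) := fun s =>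
    O.prod_mem fun j _ => (η.f j).2
  refine Converges.add ?_ ((hprod _).mul g.2)
  rw [polarPart]
  exact O.sum_mem fun i _ => ((hprod _).mul ((η.f i).2.pderiv k)).smul _

theorem leadForm_isHomogeneous {N : ℕ} (hN : η.totalOrd = N + 1) (k : Fin 2) :
    (η.leadForm k).IsHomogeneous N := by
  rw [← (polarPart_lead hN k).1]
  exact homPart_isHomogeneous _ _

/-- Euler's identity on each initial form turns the i-th term into νᵢλᵢ ∏ in(fⱼ); the factor ∑ νᵢλᵢ
vanishes. -/
theorem euler_leadForm (hres : η.MainResonant) :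
    MvPolynomial.X 0 * η.leadForm 0 + MvPolynomial.X 1 * η.leadForm 1 = 0 := by
  classical
  have h : ∀ i, MvPolynomial.X 0 * MvPolynomial.pderiv 0 (initForm (η.f i)) +
      MvPolynomial.X 1 * MvPolynomial.pderiv 1 (initForm (η.f i))
        = MvPolynomial.C (ord (η.f i) : ℂ) * initForm (η.f i) := fun i => by
    have := (homPart_isHomogeneous (ord (η.f i)) (η.f i)).sum_X_mul_pderiv
    rw [Fin.sum_univ_two, nsmul_eq_mul] at this
    rw [initForm_eq_homPart, this]
    simp
  rw [leadForm, leadForm, Finset.mul_sum, Finset.mul_sum, ← Finset.sum_add_distrib]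
  have hterm : ∀ i ∈ Finset.univ, (MvPolynomial.X 0 * (MvPolynomial.C (η.res i) *
      ((∏ j ∈ Finset.univ.erase i, initForm (η.f j)) *
        MvPolynomial.pderiv 0 (initForm (η.f i)))) +
      MvPolynomial.X 1 * (MvPolynomial.C (η.res i) *
      ((∏ j ∈ Finset.univ.erase i, initForm (η.f j)) *
        MvPolynomial.pderiv 1 (initForm (η.f i)))) : MvPolynomial (Fin 2) ℂ)
      = MvPolynomial.C ((ord (η.f i) : ℂ) * η.res i) * ∏ j, initForm (η.f j) := fun i hi => by
    rw [← Finset.prod_erase_mul _ _ hi, MvPolynomial.C_mul]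
    linear_combination MvPolynomial.C (η.res i) *
      (∏ j ∈ Finset.univ.erase i, initForm (η.f j)) * h i
  rw [Finset.sum_congr rfl hterm, ← Finset.sum_mul, ← map_sum]
  rw [MainResonant] at hres
  rw [hres, map_zero, zero_mul]

theorem radial_order {N : ℕ} (hN : η.totalOrd = N + 1) (hres : η.MainResonant) :
    ((N + 2 : ℕ) : ℕ∞) ≤ (η.ωx * MvPowerSeries.X 0 + η.ωy * MvPowerSeries.X 1).order := by
  obtain ⟨hx1, hx2⟩ := ωx_lead hN
  obtain ⟨hy1, hy2⟩ := ωy_lead hN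
  have hX : ∀ k, ((1 : ℕ) : ℕ∞) ≤ (MvPowerSeries.X k : Ser).order := fun k => by
    rw [Nat.cast_one, MvPowerSeries.one_le_order_iff_constCoeff_eq_zero]
    simp
  have hX' : ∀ k, homPart 1 (MvPowerSeries.X k : Ser) = MvPolynomial.X k := fun k => by
    classical
    ext d
    rw [coeff_homPart, ← MvPolynomial.coeff_coe, MvPolynomial.coe_X, MvPowerSeries.coeff_X]
    by_cases hd : d = Finsupp.single k 1
    · simp [hd]
    · simp [hd]
  refine lt_order_of_homPart_eq_zero (n := N + 1) ?_ ?_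
  · refine le_trans (le_min ?_ ?_) MvPowerSeries.min_order_le_add <;>
      rw [MvPowerSeries.order_mul, Nat.cast_add]
    · exact add_le_add hx2 (hX 0)
    · exact add_le_add hy2 (hX 1)
  · rw [homPart_add, homPart_mul hx2 (hX 0), homPart_mul hy2 (hX 1), hX', hX', hx1, hy1, mul_comm,
      mul_comm (η.leadForm 1)]
    exact euler_leadForm hres

/-- The leading form at v is killed by v. If it were also killed by a transversal w it would be
zero; so it is nonzero on w, which is the criterion of `transversalToDivisor_pull`. -/
theorem not_isEscapePoint {N : ℕ} (hN : η.totalOrd = N + 1) (hres : η.MainResonant)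
    {v : Fin 2 → ℂ} {k : Fin 2} (hk : MvPolynomial.eval v (η.leadForm k) ≠ 0) :
    ¬ η.IsEscapePoint v := by
  rintro ⟨-, -, w, hdet, hnot⟩
  refine hnot ?_
  obtain ⟨hx1, hx2⟩ := ωx_lead hN
  obtain ⟨hy1, hy2⟩ := ωy_lead hN
  refine transversalToDivisor_pull (A := η.ωx) (B := η.ωy) (converges_polarPart_add 0 η.αx)
    (converges_polarPart_add 1 η.αy) hx2 hy2 (radial_order hN hres) ?_
  rw [hx1, hy1]
  intro h0
  have he := congrArg (MvPolynomial.eval v) (euler_leadForm hres)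
  simp only [map_add, map_mul, MvPolynomial.eval_X, map_zero] at he
  have h1 : (v 0 * w 1 - v 1 * w 0) * MvPolynomial.eval v (η.leadForm 0) = 0 := by
    linear_combination w 1 * he - v 1 * h0
  have h2 : (v 0 * w 1 - v 1 * w 0) * MvPolynomial.eval v (η.leadForm 1) = 0 := by
    linear_combination v 0 * h0 - w 0 * he
  fin_cases k
  · exact hk ((mul_eq_zero.1 h1).resolve_left hdet)
  · exact hk ((mul_eq_zero.1 h2).resolve_left hdet)

theorem totalOrd_pos [Nonempty ι] : ∃ N, η.totalOrd = N + 1 := by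
  obtain ⟨i⟩ := ‹Nonempty ι›
  refine Nat.exists_eq_add_of_le' ((one_le_ord_of_irreducible (η.irreducible i)).trans ?_)
  exact Finset.single_le_sum (f := fun i => ord (η.f i)) (fun _ _ => Nat.zero_le _)
    (Finset.mem_univ i)

/-- Faithfulness says that ω has order exactly N, one less than f; the component of degree N of a
coefficient realizing the minimum is then nonzero. -/
theorem OneFaithful.exists_leadForm_ne_zero (h : η.OneFaithful) :
    ∃ N k, η.totalOrd = N + 1 ∧ η.leadForm k ≠ 0 := by
  rw [OneFaithful, order_F] at h
  obtain ⟨N, hN⟩ : ∃ N, η.totalOrd = N + 1 := by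
    refine Nat.exists_eq_add_of_le' (Nat.one_le_iff_ne_zero.2 fun h0 => ?_)
    rw [h0] at h
    simp at h
  obtain ⟨hx1, hx2⟩ := ωx_lead hN
  obtain ⟨hy1, hy2⟩ := ωy_lead hN
  rw [hN, Nat.cast_add, Nat.cast_one] at h
  replace h := ENat.add_left_injective_of_ne_top (by simp) h
  rcases min_choice η.ωx.order η.ωy.order with hm | hm <;> rw [hm] at h
  · exact ⟨N, 0, hN, by rw [← hx1]; exact homPart_ne_zero h.symm⟩
  · exact ⟨N, 1, hN, by rw [← hy1]; exact homPart_ne_zero h.symm⟩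

end LogForm

/-! ### Complex conjugation and associated germs. -/

section Conj

theorem conj_mul (f g : O) : conj (f * g) = conj f * conj g :=
  Subtype.ext (map_mul (MvPowerSeries.map (starRingEnd ℂ)) (f : Ser) (g : Ser))

theorem conj_conj (f : O) : conj (conj f) = f := by
  apply Subtype.ext
  ext d
  simp [conj]

theorem conj_one : conj 1 = 1 :=
  Subtype.ext (map_one (MvPowerSeries.map (starRingEnd ℂ)))

theorem associated_conj {f g : O} (h : Associated f g) : Associated (conj f) (conj g) := by
  obtain ⟨u, rfl⟩ := h
  rw [conj_mul]
  refine associated_mul_unit_right (conj f) (conj (u : O)) ?_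
  exact IsUnit.of_mul_eq_one (conj ((u⁻¹ : Oˣ) : O)) (by rw [← conj_mul, Units.mul_inv, conj_one])

theorem ord_conj (f : O) : ord (conj f) = ord f := by
  have h : ∀ f : O, (f : Ser).order ≤ (conj f : Ser).order := fun f =>
    MvPowerSeries.le_order_map (starRingEnd ℂ)
  have h2 := h (conj f)
  rw [conj_conj] at h2
  rw [ord, ord, le_antisymm (h f) h2]

theorem initForm_conj (f : O) :
    initForm (conj f) = MvPolynomial.map (starRingEnd ℂ) (initForm f) := by
  rw [initForm_eq_homPart, initForm_eq_homPart, ord_conj]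
  ext d
  rw [coeff_homPart, MvPolynomial.coeff_map, coeff_homPart]
  split_ifs
  · simp [conj]
  · simp

theorem lineEval_map (φ : ℂ →+* ℂ) {v w : Fin 2 → ℂ} (hv : ∀ k, φ (v k) = v k)
    (hw : ∀ k, φ (w k) = w k) (F : MvPolynomial (Fin 2) ℂ) :
    lineEval v w (MvPolynomial.map φ F) = (lineEval v w F).map φ := by
  induction F using MvPolynomial.induction_on with
  | C a => simp
  | add p q hp hq => simp [hp, hq]
  | mul_X p k hp =>
    rw [map_mul, MvPolynomial.map_X, map_mul, map_mul, lineEval_X, Polynomial.map_mul, hp]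
    simp [hv, hw]

theorem conePoly_eq_lineEval (E : GL (Fin 2) ℝ) (f : O) :
    conePoly E f = lineEval (fun k => ((E k 0 : ℝ) : ℂ)) (fun k => ((E k 1 : ℝ) : ℂ))
      (initForm f) := rfl

theorem conePoly_conj (E : GL (Fin 2) ℝ) (f : O) :
    conePoly E (conj f) = (conePoly E f).map (starRingEnd ℂ) := by
  rw [conePoly_eq_lineEval, initForm_conj, lineEval_map] <;> simp [conePoly_eq_lineEval]

/-- A unit has order 0, so the leading form is only multiplied by its value at the origin. Tangent
cones thus depend on the branch and not on its equation. -/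
theorem initForm_of_associated {f g : O} (hf : f ≠ 0) (h : Associated f g) :
    ∃ c : ℂ, c ≠ 0 ∧ initForm g = MvPolynomial.C c * initForm f := by
  obtain ⟨u, rfl⟩ := h
  have hc : MvPowerSeries.constantCoeff ((u : O) : Ser) ≠ 0 :=
    (isUnit_iff_constantCoeff_ne_zero (u : O)).1 u.isUnit
  have hu : ((u : O) : Ser).order = 0 := by
    by_contra h
    exact hc (MvPowerSeries.order_ne_zero_iff_constCoeff_eq_zero.1 h)
  refine ⟨MvPowerSeries.constantCoeff ((u : O) : Ser), hc, ?_⟩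
  have hord : ord (f * (u : O)) = ord f + 0 := by
    rw [ord, Subring.coe_mul, MvPowerSeries.order_mul, hu, add_zero, add_zero, ord]
  have h0 : homPart 0 ((u : O) : Ser) =
      MvPolynomial.C (MvPowerSeries.constantCoeff ((u : O) : Ser)) := by
    ext d
    rw [coeff_homPart, MvPolynomial.coeff_C]
    by_cases hd : d = 0
    · simp [hd]
    · have hd' : ¬ d.degree = 0 := fun h => hd ((Finsupp.degree_eq_zero_iff d).1 h)
      simp [hd', Ne.symm hd]
  rw [initForm_eq_homPart, hord, Subring.coe_mul, homPart_mul (order_eq_ord hf).ge (by simp), h0,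
    mul_comm, ← initForm_eq_homPart]

theorem conePoly_of_associated (E : GL (Fin 2) ℝ) {f g : O} (hf : f ≠ 0) (h : Associated f g) :
    ∃ c : ℂ, c ≠ 0 ∧ conePoly E g = C c * conePoly E f := by
  obtain ⟨c, hc, h⟩ := initForm_of_associated hf h
  refine ⟨c, hc, ?_⟩
  rw [conePoly_eq_lineEval, h, map_mul, ← conePoly_eq_lineEval, lineEval_C]

theorem conePoly_of_associated_conj (E : GL (Fin 2) ℝ) {f g : O} (hf : f ≠ 0)
    (h : Associated (conj f) g) :
    ∃ c : ℂ, c ≠ 0 ∧ conePoly E g = C c * (conePoly E f).map (starRingEnd ℂ) := by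
  rw [← conePoly_conj]
  refine conePoly_of_associated E (fun h0 => hf ?_) h
  rw [← conj_conj f, h0]
  exact Subtype.ext (map_zero (MvPowerSeries.map (starRingEnd ℂ)))

theorem exists_real_of_map_conj_eq {p : ℂ[X]} (h : p.map (starRingEnd ℂ) = p) :
    ∃ q : ℝ[X], q.map Complex.ofRealHom = p := by
  refine (mem_lifts p).1 ((lifts_iff_coeff_lifts p).2 fun n => ?_)
  have h1 := congrArg (fun q => q.coeff n) h
  simp only [coeff_map] at h1
  obtain ⟨r, hr⟩ := Complex.conj_eq_iff_real.1 h1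
  exact ⟨r, hr.symm⟩

end Conj

theorem polarNum_sum {κ : Type*} [Fintype κ] (S : Finset ℂ) (c : κ → ℂ) (m : κ → ℂ → ℂ) :
    (polarNum S fun a => ∑ i, c i * m i a) = ∑ i, C (c i) * polarNum S (m i) := by
  simp only [polarNum, Finset.mul_sum]
  rw [Finset.sum_comm]
  refine Finset.sum_congr rfl fun a _ => ?_
  rw [map_sum, Finset.sum_mul]
  refine Finset.sum_congr rfl fun i _ => ?_
  rw [C_mul, mul_assoc]

namespace LogForm

variable {ι : Type*} [Fintype ι] {η : LogForm ι}

theorem mem_cone {E : GL (Fin 2) ℝ} {a : ℂ} :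
    a ∈ η.cone E ↔ ∃ i, a ∈ (conePoly E (η.f i)).roots := by
  simp [cone]

theorem escapePoly_eq_polarNum (η : LogForm ι) (E : GL (Fin 2) ℝ) :
    η.escapePoly E = polarNum (η.cone E) (η.rho E) := rfl

/-! ### Symmetric forms have real escape functions. -/

section Symmetry

/-- Conjugation is an involution on branches and the poles are distinct branches, so the chosen map
of the finite index set is injective, hence bijective. -/
theorem IsSymmetric.exists_perm (h : η.IsSymmetric) :
    ∃ σ : ι ≃ ι, ∀ i, Associated (conj (η.f i)) (η.f (σ i)) ∧
      η.res (σ i) = starRingEnd ℂ (η.res i) := by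
  choose σ hσ using h.1
  have hinj : Function.Injective σ := fun i j hij => by
    by_contra hne
    have h1 : Associated (conj (η.f i)) (conj (η.f j)) :=
      (hσ i).1.trans (hij ▸ (hσ j).1.symm)
    have h2 := associated_conj h1
    rw [conj_conj, conj_conj] at h2
    exact η.distinct i j hne h2
  exact ⟨Equiv.ofBijective σ (Finite.injective_iff_bijective.1 hinj), hσ⟩

theorem IsSymmetric.rho_conj (h : η.IsSymmetric) (E : GL (Fin 2) ℝ) (a : ℂ) :
    η.rho E (starRingEnd ℂ a) = starRingEnd ℂ (η.rho E a) := by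
  obtain ⟨σ, hσ⟩ := h.exists_perm
  rw [rho, rho, map_sum, ← Equiv.sum_comp σ]
  refine Finset.sum_congr rfl fun i _ => ?_
  obtain ⟨c, hc, hp⟩ := conePoly_of_associated_conj E (η.irreducible i).ne_zero (hσ i).1
  rw [(hσ i).2, map_mul, map_natCast, hp, ← count_roots, roots_C_mul _ hc, count_roots,
    ← eq_rootMultiplicity_map (starRingEnd ℂ).injective]

theorem IsSymmetric.conj_mem_cone (h : η.IsSymmetric) {E : GL (Fin 2) ℝ} {a : ℂ}
    (ha : a ∈ η.cone E) : starRingEnd ℂ a ∈ η.cone E := by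
  obtain ⟨i, hi⟩ := mem_cone.1 ha
  obtain ⟨j, hj, -⟩ := h.1 i
  obtain ⟨c, hc, hp⟩ := conePoly_of_associated_conj E (η.irreducible i).ne_zero hj
  refine mem_cone.2 ⟨j, ?_⟩
  have h0 : (conePoly E (η.f i)).map (starRingEnd ℂ) ≠ 0 :=
    (Polynomial.map_ne_zero_iff (starRingEnd ℂ).injective).2 (ne_zero_of_mem_roots hi)
  rw [hp, roots_C_mul _ hc, mem_roots h0]
  exact (isRoot_of_mem_roots hi).map

theorem IsSymmetric.image_conj_cone (h : η.IsSymmetric) (E : GL (Fin 2) ℝ) :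
    (η.cone E).image (starRingEnd ℂ) = η.cone E := by
  ext a
  rw [Finset.mem_image]
  constructor
  · rintro ⟨b, hb, rfl⟩
    exact h.conj_mem_cone hb
  · exact fun ha => ⟨_, h.conj_mem_cone ha, Complex.conj_conj a⟩

theorem IsSymmetric.exists_real_escapePoly (h : η.IsSymmetric) (E : GL (Fin 2) ℝ) :
    ∃ P Q : ℝ[X], P.map Complex.ofRealHom = η.escapePoly E ∧
      Q.map Complex.ofRealHom = poleProd (η.cone E) := by
  obtain ⟨P, hP⟩ := exists_real_of_map_conj_eq (p := η.escapePoly E) (by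
    rw [escapePoly_eq_polarNum, map_polarNum _ _ _ (η.rho E) fun a _ => h.rho_conj E a,
      h.image_conj_cone])
  obtain ⟨Q, hQ⟩ := exists_real_of_map_conj_eq (p := poleProd (η.cone E)) (by
    rw [map_poleProd, h.image_conj_cone])
  exact ⟨P, Q, hP, hQ⟩

end Symmetry

/-! ### The leading form in the affine coordinate of D and at infinity. -/

section Degree

variable {E : GL (Fin 2) ℝ}

theorem det_ne_zero (E : GL (Fin 2) ℝ) :
    ((E 0 0 : ℝ) : ℂ) * ((E 1 1 : ℝ) : ℂ) - ((E 0 1 : ℝ) : ℂ) * ((E 1 0 : ℝ) : ℂ) ≠ 0 := by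
  have h : (E : Matrix (Fin 2) (Fin 2) ℝ).det ≠ 0 :=
    ((Matrix.isUnit_iff_isUnit_det _).1 E.isUnit).ne_zero
  rw [Matrix.det_fin_two] at h
  exact_mod_cast h

theorem conePoly_natDegree {f : O}
    (h : MvPolynomial.eval (fun k => ((E k 1 : ℝ) : ℂ)) (initForm f) ≠ 0) :
    conePoly E f ≠ 0 ∧ (conePoly E f).natDegree = ord f := by
  have hF := homPart_isHomogeneous (ord f) (f : Ser)
  rw [← initForm_eq_homPart] at hF
  have h1 : (conePoly E f).coeff (ord f) ≠ 0 := by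
    rw [conePoly_eq_lineEval, coeff_lineEval hF]
    exact h
  exact ⟨fun h0 => h1 (by rw [h0, coeff_zero]),
    le_antisymm (natDegree_lineEval_le hF _ _) (le_natDegree_of_ne_zero h1)⟩

/-- The numerator of the logarithmic derivative `∑ i, res i * p i' / p i` of the tangent cones. -/
def coneLogNum (η : LogForm ι) (E : GL (Fin 2) ℝ) : ℂ[X] :=
  open Classical in
  ∑ i, C (η.res i) * ((∏ j ∈ Finset.univ.erase i, conePoly E (η.f j)) *
    derivative (conePoly E (η.f i)))

theorem lineEval_leadForm (η : LogForm ι) (v w : Fin 2 → ℂ) (k : Fin 2) :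
    lineEval v w (η.leadForm k) =
      open Classical in
      ∑ i, C (η.res i) * ((∏ j ∈ Finset.univ.erase i, lineEval v w (initForm (η.f j))) *
        lineEval v w (MvPolynomial.pderiv k (initForm (η.f i)))) := by
  rw [leadForm, map_sum]
  refine Finset.sum_congr rfl fun i _ => ?_
  rw [map_mul, map_mul, map_prod, lineEval_C]

theorem coneLogNum_eq (η : LogForm ι) (E : GL (Fin 2) ℝ) :
    η.coneLogNum E = C ((E 0 1 : ℝ) : ℂ) *
        lineEval (fun k => ((E k 0 : ℝ) : ℂ)) (fun k => ((E k 1 : ℝ) : ℂ)) (η.leadForm 0) +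
      C ((E 1 1 : ℝ) : ℂ) *
        lineEval (fun k => ((E k 0 : ℝ) : ℂ)) (fun k => ((E k 1 : ℝ) : ℂ)) (η.leadForm 1) := by
  rw [lineEval_leadForm, lineEval_leadForm, Finset.mul_sum, Finset.mul_sum,
    ← Finset.sum_add_distrib, coneLogNum]
  refine Finset.sum_congr rfl fun i _ => ?_
  simp only [conePoly_eq_lineEval, derivative_lineEval]
  ring

/-- Both sides come from ∑ λᵢ pᵢ'/pᵢ = ∑ ρ_a/(t - a), by expanding each logarithmic derivative over
the points of the cone. -/
theorem escapePoly_mul_prod (hp : ∀ i, conePoly E (η.f i) ≠ 0) :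
    η.escapePoly E * ∏ i, conePoly E (η.f i) = η.coneLogNum E * poleProd (η.cone E) := by
  classical
  rw [escapePoly_eq_polarNum]
  have h : (polarNum (η.cone E) (η.rho E)) = ∑ i, C (η.res i) * polarNum (η.cone E)
      fun a => ((conePoly E (η.f i)).rootMultiplicity a : ℂ) := polarNum_sum _ _ _
  rw [h, coneLogNum, Finset.sum_mul, Finset.sum_mul]
  refine Finset.sum_congr rfl fun i hi => ?_
  have h1 := derivative_mul_poleProd (hp i) (S := η.cone E) fun a ha =>
    mem_cone.2 ⟨i, (mem_roots (hp i)).2 ha⟩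
  rw [← Finset.prod_erase_mul _ _ hi]
  linear_combination (-C (η.res i) * ∏ j ∈ Finset.univ.erase i, conePoly E (η.f j)) * h1

/-- The degree of the escape polynomial detects whether the leading form vanishes at infinity. -/
theorem exists_leadForm_ne_zero_iff {N : ℕ} (hN : η.totalOrd = N + 1) (hres : η.MainResonant)
    (he : ∀ i, MvPolynomial.eval (fun k => ((E k 1 : ℝ) : ℂ)) (initForm (η.f i)) ≠ 0) :
    (∃ k, MvPolynomial.eval (fun k => ((E k 1 : ℝ) : ℂ)) (η.leadForm k) ≠ 0) ↔
      η.escapePoly E ≠ 0 ∧ (η.escapePoly E).natDegree + 2 = (η.cone E).card := by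
  set v : Fin 2 → ℂ := fun k => ((E k 0 : ℝ) : ℂ) with hv
  set e : Fin 2 → ℂ := fun k => ((E k 1 : ℝ) : ℂ) with hedef
  set L₀ := MvPolynomial.eval e (η.leadForm 0) with hL₀
  set L₁ := MvPolynomial.eval e (η.leadForm 1) with hL₁
  set K := η.coneLogNum E with hK
  have hp : ∀ i, conePoly E (η.f i) ≠ 0 := fun i => (conePoly_natDegree (he i)).1
  have hprod0 : ∏ i, conePoly E (η.f i) ≠ 0 := Finset.prod_ne_zero_iff.2 fun i _ => hp i
  have hprod : (∏ i, conePoly E (η.f i)).natDegree = N + 1 := by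
    rw [natDegree_prod _ _ fun i _ => hp i, ← hN, totalOrd]
    exact Finset.sum_congr rfl fun i _ => (conePoly_natDegree (he i)).2
  have hZ0 : poleProd (η.cone E) ≠ 0 := (poleProd_monic _).ne_zero
  have hmain : η.escapePoly E * ∏ i, conePoly E (η.f i) = K * poleProd (η.cone E) :=
    escapePoly_mul_prod hp
  have hKeq : K = C (e 0) * lineEval v e (η.leadForm 0) + C (e 1) * lineEval v e (η.leadForm 1) :=
    coneLogNum_eq η E
  set L := C (v 0) * lineEval v e (η.leadForm 0) + C (v 1) * lineEval v e (η.leadForm 1) with hL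
  -- The vanishing radial contraction at the point v + te, split into its v-part L and its e-part
  -- tK.
  have hrel : L + X * K = 0 := by
    have h := congrArg (lineEval v e) (euler_leadForm hres)
    rw [map_add, map_mul, map_mul, lineEval_X, lineEval_X, map_zero] at h
    rw [hKeq, hL]
    linear_combination h
  have hdeg : ∀ k, (lineEval v e (η.leadForm k)).natDegree ≤ N := fun k =>
    natDegree_lineEval_le (leadForm_isHomogeneous hN k) v e
  have hcoeff : ∀ k, (lineEval v e (η.leadForm k)).coeff N = MvPolynomial.eval e (η.leadForm k) :=
    fun k => coeff_lineEval (leadForm_isHomogeneous hN k) v e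
  have hLdeg : L.natDegree ≤ N := natDegree_add_le_of_degree_le
    ((natDegree_C_mul_le _ _).trans (hdeg 0)) ((natDegree_C_mul_le _ _).trans (hdeg 1))
  have hLN : L.coeff N = v 0 * L₀ + v 1 * L₁ := by
    rw [hL, coeff_add, coeff_C_mul, coeff_C_mul, hcoeff, hcoeff]
  have hKN : K.coeff N = e 0 * L₀ + e 1 * L₁ := by
    rw [hKeq, coeff_add, coeff_C_mul, coeff_C_mul, hcoeff, hcoeff]
  -- L has degree at most N, so K = -L/t has degree at most N - 1; its coefficient of degree N - 1
  -- is minus that of degree N in L.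
  have hKtop : ∀ n, N ≤ n → K.coeff n = 0 := fun n hn => by
    have h := congrArg (fun q => q.coeff (n + 1)) hrel
    simp only [coeff_add, coeff_X_mul, coeff_zero] at h
    rwa [coeff_eq_zero_of_natDegree_lt (by omega), zero_add] at h
  have hdet : v 0 * e 1 - e 0 * v 1 ≠ 0 := det_ne_zero E
  -- The leading form at e is killed by e, the coefficient of degree N of K being zero. If v kills
  -- it as well, it vanishes, since v and e are independent.
  have hlin : v 0 * L₀ + v 1 * L₁ = 0 → L₀ = 0 ∧ L₁ = 0 := fun h0 => by
    have h1 : e 0 * L₀ + e 1 * L₁ = 0 := by rw [← hKN, hKtop N le_rfl]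
    constructor
    · have : (v 0 * e 1 - e 0 * v 1) * L₀ = 0 := by linear_combination e 1 * h0 - v 1 * h1
      exact (mul_eq_zero.1 this).resolve_left hdet
    · have : (v 0 * e 1 - e 0 * v 1) * L₁ = 0 := by linear_combination v 0 * h1 - e 0 * h0
      exact (mul_eq_zero.1 this).resolve_left hdet
  have hcomp : ∀ M, N = M + 1 → K.coeff M = -(v 0 * L₀ + v 1 * L₁) := fun M hM => by
    have h := congrArg (fun q => q.coeff (M + 1)) hrel
    simp only [coeff_add, coeff_X_mul, coeff_zero] at h
    rw [← hM, hLN] at h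
    linear_combination h
  constructor
  · rintro ⟨k, hk⟩
    have hne : v 0 * L₀ + v 1 * L₁ ≠ 0 := fun h0 => by
      obtain ⟨h1, h2⟩ := hlin h0
      fin_cases k
      · exact hk h1
      · exact hk h2
    obtain ⟨M, rfl⟩ : ∃ M, N = M + 1 := by
      refine Nat.exists_eq_succ_of_ne_zero fun h0 => hne ?_
      have h := congrArg (fun q => q.coeff 0) hrel
      simp only [coeff_add, mul_coeff_zero, coeff_X_zero, zero_mul, add_zero, coeff_zero] at h
      rw [← hLN, h0, h]
    have hKM : K.coeff M ≠ 0 := by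
      rw [hcomp M rfl]
      exact neg_ne_zero.2 hne
    have hK0 : K ≠ 0 := fun h => hKM (by rw [h, coeff_zero])
    have hKdeg : K.natDegree = M := by
      refine le_antisymm (natDegree_le_iff_coeff_eq_zero.2 fun n hn => hKtop n hn) ?_
      exact le_natDegree_of_ne_zero hKM
    have hP0 : η.escapePoly E ≠ 0 := fun h => by
      rw [h, zero_mul] at hmain
      exact mul_ne_zero hK0 hZ0 hmain.symm
    refine ⟨hP0, ?_⟩
    -- deg P_η + (N + 1) = deg K + ℓ, so deg P_η = ℓ - 2 amounts to deg K = N - 1.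
    have h := congrArg natDegree hmain
    rw [natDegree_mul hP0 hprod0, natDegree_mul hK0 hZ0, hprod, hKdeg, natDegree_poleProd] at h
    omega
  · rintro ⟨hP0, hPdeg⟩
    have hK0 : K ≠ 0 := fun h => by
      rw [h, zero_mul] at hmain
      exact mul_ne_zero hP0 hprod0 hmain
    have h := congrArg natDegree hmain
    rw [natDegree_mul hP0 hprod0, natDegree_mul hK0 hZ0, hprod, natDegree_poleProd] at h
    by_contra! hcon
    have h0 : L₀ = 0 := hcon 0
    have h1 : L₁ = 0 := hcon 1
    refine hK0 (leadingCoeff_eq_zero.1 ?_)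
    rw [leadingCoeff, hcomp K.natDegree (by omega), h0, h1]
    simp

end Degree

end LogForm

/-! ### Smooth branches and lines. -/

section LinearForm

/-- The linear form `α x + β y`. -/
def linForm (α β : ℂ) : O :=
  ⟨MvPowerSeries.C α * MvPowerSeries.X 0 + MvPowerSeries.C β * MvPowerSeries.X 1,
    ((converges_C α).mul (converges_X 0)).add ((converges_C β).mul (converges_X 1))⟩

theorem homPart_one (f : Ser) : homPart 1 f =
    MvPolynomial.C (MvPowerSeries.coeff (Finsupp.single 0 1) f) * MvPolynomial.X 0 +
      MvPolynomial.C (MvPowerSeries.coeff (Finsupp.single 1 1) f) * MvPolynomial.X 1 := by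
  have h : (Finset.HasAntidiagonal.antidiagonal 1 : Finset (ℕ × ℕ)) = {(0, 1), (1, 0)} := rfl
  rw [homPart, h, Finset.sum_pair (by simp), add_comm]
  simp [MvPolynomial.C_mul_X_eq_monomial]

theorem homPart_one_linForm (α β : ℂ) : homPart 1 (linForm α β : Ser) =
    MvPolynomial.C α * MvPolynomial.X 0 + MvPolynomial.C β * MvPolynomial.X 1 := by
  classical
  rw [homPart_one]
  simp [linForm, MvPowerSeries.coeff_C_mul, MvPowerSeries.coeff_X, Finsupp.single_left_inj]

theorem order_linForm {α β : ℂ} (h : ¬ (α = 0 ∧ β = 0)) : (linForm α β : Ser).order = 1 := by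
  refine le_antisymm ?_ (MvPowerSeries.one_le_order_iff_constCoeff_eq_zero.2 (by simp [linForm]))
  by_contra! hlt
  have h0 : homPart 1 (linForm α β : Ser) = 0 := homPart_eq_zero (by exact_mod_cast hlt)
  rw [homPart_one_linForm] at h0
  refine h ⟨?_, ?_⟩
  · simpa using congrArg (MvPolynomial.eval ![1, 0]) h0
  · simpa using congrArg (MvPolynomial.eval ![0, 1]) h0

theorem ord_eq_one {f : O} (hf : (f : Ser).order = 1) : ord f = 1 := by
  rw [ord, hf]
  rfl

theorem conePoly_linForm_isRoot (E : GL (Fin 2) ℝ) {α β : ℂ} (h : ¬ (α = 0 ∧ β = 0)) {a : ℂ}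
    (ha : α * (E 0 0 + E 0 1 * a) + β * (E 1 0 + E 1 1 * a) = 0) :
    (conePoly E (linForm α β)).IsRoot a := by
  rw [IsRoot, conePoly_eq_lineEval, eval_lineEval, initForm_eq_homPart,
    ord_eq_one (order_linForm h), homPart_one_linForm]
  simpa using ha

theorem conj_linForm {α β : ℂ} (hα : starRingEnd ℂ α = α) (hβ : starRingEnd ℂ β = β) :
    conj (linForm α β) = linForm α β := by
  apply Subtype.ext
  simp [conj, linForm, hα, hβ]

/-- A smooth branch tangent to `t = a` is tangent to no other line. -/
theorem conePoly_of_smooth {E : GL (Fin 2) ℝ} {f : O} (hf : (f : Ser).order = 1) {a : ℂ}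
    (ha : (conePoly E f).IsRoot a) :
    MvPolynomial.eval (fun k => ((E k 1 : ℝ) : ℂ)) (initForm f) ≠ 0 ∧
      (conePoly E f).roots = {a} := by
  have hord := ord_eq_one hf
  have hne : initForm f ≠ 0 := by
    rw [initForm_eq_homPart, hord]
    exact homPart_ne_zero (by rw [hf]; rfl)
  have he : MvPolynomial.eval (fun k => ((E k 1 : ℝ) : ℂ)) (initForm f) ≠ 0 := by
    intro h1
    have h2 := ha
    rw [IsRoot, conePoly_eq_lineEval, eval_lineEval] at h2
    rw [initForm_eq_homPart, hord, homPart_one] at h1 h2 hne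
    set α := MvPowerSeries.coeff (Finsupp.single 0 1) (f : Ser)
    set β := MvPowerSeries.coeff (Finsupp.single 1 1) (f : Ser)
    simp only [map_add, map_mul, MvPolynomial.eval_C, MvPolynomial.eval_X] at h1 h2
    have hdet := LogForm.det_ne_zero E
    have h3 : (((E 0 0 : ℝ) : ℂ) * ((E 1 1 : ℝ) : ℂ) - ((E 0 1 : ℝ) : ℂ) * ((E 1 0 : ℝ) : ℂ)) * α
        = 0 := by
      linear_combination ((E 1 1 : ℝ) : ℂ) * h2 - (((E 1 0 : ℝ) : ℂ) + ((E 1 1 : ℝ) : ℂ) * a) * h1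
    have h4 : (((E 0 0 : ℝ) : ℂ) * ((E 1 1 : ℝ) : ℂ) - ((E 0 1 : ℝ) : ℂ) * ((E 1 0 : ℝ) : ℂ)) * β
        = 0 := by
      linear_combination (((E 0 0 : ℝ) : ℂ) + ((E 0 1 : ℝ) : ℂ) * a) * h1 - ((E 0 1 : ℝ) : ℂ) * h2
    rw [(mul_eq_zero.1 h3).resolve_left hdet, (mul_eq_zero.1 h4).resolve_left hdet] at hne
    simp at hne
  obtain ⟨h0, hdeg⟩ := LogForm.conePoly_natDegree he
  refine ⟨he, (Multiset.eq_of_le_of_card_le ?_ ?_).symm⟩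
  · exact Multiset.singleton_le.2 ((mem_roots h0).2 ha)
  · rw [Multiset.card_singleton, ← hord, ← hdeg]
    exact card_roots' _

end LinearForm

theorem roots_conePoly_of_associated (E : GL (Fin 2) ℝ) {f g : O} (hf : f ≠ 0)
    (h : Associated f g) : (conePoly E g).roots = (conePoly E f).roots := by
  obtain ⟨c, hc, hp⟩ := conePoly_of_associated E hf h
  rw [hp, roots_C_mul _ hc]

/-! ### Adapted coordinates, modifications and the conclusion. -/

namespace LogForm

variable {ι : Type*} [Fintype ι] {η : LogForm ι}

theorem exists_adapted (hres : η.MainResonant) (hfaith : η.OneFaithful) :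
    ∃ E : GL (Fin 2) ℝ, η.Adapted E := by
  obtain ⟨N, k, hN, hk⟩ := hfaith.exists_leadForm_ne_zero
  have hform : ∀ i, initForm (η.f i) ≠ 0 := fun i => by
    rw [initForm_eq_homPart]
    exact homPart_ne_zero (order_f i).symm
  -- A nonzero polynomial cannot vanish on all of ℝ², so a real direction avoids the leading form
  -- and all the tangent cones. The factor x makes the matrix with columns (0, 1) and that direction
  -- invertible.
  have hne : η.leadForm k * (∏ i, initForm (η.f i)) * MvPolynomial.X 0 ≠ 0 :=
    mul_ne_zero (mul_ne_zero hk (Finset.prod_ne_zero_iff.2 fun i _ => hform i))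
      (MvPolynomial.X_ne_zero 0)
  obtain ⟨x, hx⟩ : ∃ x : Fin 2 → ℝ, MvPolynomial.eval (fun j => (x j : ℂ))
      (η.leadForm k * (∏ i, initForm (η.f i)) * MvPolynomial.X 0) ≠ 0 := by
    by_contra! hcon
    refine hne (MvPolynomial.funext_set (fun _ => Set.range ((↑) : ℝ → ℂ))
      (fun _ => Set.infinite_range_of_injective Complex.ofReal_injective) fun y hy => ?_)
    choose x hx using fun j => hy j (Set.mem_univ j)
    rw [map_zero, ← hcon x]
    congr 2
    exact funext fun j => (hx j).symm
  rw [map_mul, map_mul, map_prod, MvPolynomial.eval_X] at hx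
  obtain ⟨hx1, hx0⟩ := mul_ne_zero_iff.1 hx
  obtain ⟨hxk, hxi⟩ := mul_ne_zero_iff.1 hx1
  have hdet : (!![0, x 0; 1, x 1] : Matrix (Fin 2) (Fin 2) ℝ).det ≠ 0 := by
    rw [Matrix.det_fin_two_of]
    simpa using hx0
  set E : GL (Fin 2) ℝ := Matrix.GeneralLinearGroup.mkOfDetNeZero _ hdet with hE
  have hcol : (fun j => ((E j 1 : ℝ) : ℂ)) = fun j => (x j : ℂ) := by
    funext j
    fin_cases j <;> rfl
  have he : ∀ i, MvPolynomial.eval (fun k => ((E k 1 : ℝ) : ℂ)) (initForm (η.f i)) ≠ 0 := by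
    intro i
    rw [hcol]
    exact Finset.prod_ne_zero_iff.1 hxi i (Finset.mem_univ i)
  exact ⟨E, he, (exists_leadForm_ne_zero_iff hN hres he).1 ⟨k, by rw [hcol]; exact hxk⟩⟩

section Modification

variable {E : GL (Fin 2) ℝ} {s : ℕ} {τ : Fin s → ℂ × ℂ} {η' : LogForm (ι ⊕ Fin s)}

theorem IsModification.roots_inr (h : η.IsModification E τ η') (i : Fin s) :
    (conePoly E (η'.f (Sum.inr i))).roots = {(τ i).1} :=
  (conePoly_of_smooth (h.smooth i) (h.tangent i)).2

theorem IsModification.eval_initForm_ne_zero (h : η.IsModification E τ η')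
    (he : ∀ i, MvPolynomial.eval (fun k => ((E k 1 : ℝ) : ℂ)) (initForm (η.f i)) ≠ 0) :
    ∀ i, MvPolynomial.eval (fun k => ((E k 1 : ℝ) : ℂ)) (initForm (η'.f i)) ≠ 0 := by
  rintro (i | i)
  · rw [h.f_inl]
    exact he i
  · exact (conePoly_of_smooth (h.smooth i) (h.tangent i)).1

theorem IsModification.mainResonant (h : η.IsModification E τ η') (hres : η.MainResonant)
    (hsum : ∑ i, (τ i).2 = 0) : η'.MainResonant := by
  rw [MainResonant, Fintype.sum_sum_type]
  simp only [h.f_inl, h.res_inl, h.res_inr, ord_eq_one (h.smooth _), Nat.cast_one, one_mul, hsum,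
    add_zero]
  exact hres

theorem IsModification.cone_eq (h : η.IsModification E τ η') :
    η'.cone E = η.cone E ∪ Finset.univ.image fun i => (τ i).1 := by
  ext a
  rw [mem_cone, Finset.mem_union, mem_cone, Finset.mem_image, Sum.exists]
  simp only [h.f_inl, h.roots_inr, Multiset.mem_singleton, Finset.mem_univ, true_and]
  simp only [eq_comm]

theorem IsModification.disjoint_cone (h : η.IsModification E τ η') :
    Disjoint (η.cone E) (Finset.univ.image fun i => (τ i).1) := by
  rw [Finset.disjoint_right]
  intro a ha
  obtain ⟨i, -, rfl⟩ := Finset.mem_image.1 ha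
  exact h.params.2.1 i

theorem IsModification.rho_eq (h : η.IsModification E τ η') (a : ℂ) :
    η'.rho E a = η.rho E a + ∑ i, (τ i).2 * if a = (τ i).1 then 1 else 0 := by
  rw [rho, rho, Fintype.sum_sum_type]
  simp only [h.f_inl, h.res_inl, h.res_inr]
  congr 1
  refine Finset.sum_congr rfl fun i _ => ?_
  rw [← count_roots, h.roots_inr, Multiset.count_singleton]
  simp

theorem rho_eq_zero {a : ℂ} (ha : a ∉ η.cone E) : η.rho E a = 0 := by
  rw [rho]
  refine Finset.sum_eq_zero fun i _ => ?_
  rw [← count_roots, Multiset.count_eq_zero.2 fun h => ha (mem_cone.2 ⟨i, h⟩)]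
  simp

/-- The new points lie off the old cone and are distinct, so the residues at old points are
unchanged and each new point carries its own λ'. Only the values of d at the new points matter. -/
theorem IsModification.escapePoly_eq (h : η.IsModification E τ η') {d : ℂ → ℂ}
    (hd : ∀ i, d (τ i).1 = (τ i).2) :
    η'.escapePoly E = η.escapePoly E * poleProd (Finset.univ.image fun i => (τ i).1) +
      poleProd (η.cone E) * polarNum (Finset.univ.image fun i => (τ i).1) d := by
  rw [escapePoly_eq_polarNum, h.cone_eq, polarNum_union h.disjoint_cone, escapePoly_eq_polarNum]
  congr 2
  · refine polarNum_congr fun a ha => ?_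
    rw [h.rho_eq, Finset.sum_eq_zero, add_zero]
    intro i _
    rw [if_neg, mul_zero]
    rintro rfl
    exact h.params.2.1 i ha
  · refine polarNum_congr fun a ha => ?_
    obtain ⟨i, -, rfl⟩ := Finset.mem_image.1 ha
    rw [h.rho_eq, rho_eq_zero (h.params.2.1 i), zero_add, hd, Finset.sum_eq_single i]
    · simp
    · intro j _ hj
      rw [if_neg, mul_zero]
      exact fun h0 => hj (h.params.1 h0.symm)
    · simp

/-- Real lines, with real residues, give a symmetric modification. -/
theorem exists_isSymmetricModification
    (hτ : η.IsParameterSet E τ) (a l : Fin s → ℝ) (hal : ∀ i, τ i = ((a i : ℂ), (l i : ℂ))) :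
    ∃ η' : LogForm (ι ⊕ Fin s), η.IsSymmetricModification E τ η' := by
  have hfin := det_ne_zero E
  -- The equation of the line spanned by E(1, a), with real coefficients and hence fixed by
  -- conjugation.
  set g : Fin s → O := fun i => linForm (E 1 0 + E 1 1 * a i) (-(E 0 0 + E 0 1 * a i)) with hg
  have hne : ∀ i, ¬ (((E 1 0 : ℝ) + (E 1 1 : ℝ) * a i : ℂ) = 0 ∧
      (-((E 0 0 : ℝ) + (E 0 1 : ℝ) * a i) : ℂ) = 0) := fun i ⟨h1, h2⟩ => by
    apply hfin
    linear_combination (-((E 1 1 : ℝ) : ℂ)) * h2 - ((E 0 1 : ℝ) : ℂ) * h1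
  have horder : ∀ i, (g i : Ser).order = 1 := fun i => order_linForm (hne i)
  have hroot : ∀ i, (conePoly E (g i)).IsRoot (τ i).1 := fun i => by
    refine conePoly_linForm_isRoot E (hne i) ?_
    rw [hal]
    ring
  have hroots : ∀ i, (conePoly E (g i)).roots = {(τ i).1} := fun i =>
    (conePoly_of_smooth (horder i) (hroot i)).2
  have hirr : ∀ i, Irreducible (g i) := fun i => irreducible_of_order_eq_one (horder i)
  have hmixed : ∀ i j, ¬ Associated (η.f i) (g j) := fun i j hij => by
    have h1 := roots_conePoly_of_associated E (η.irreducible i).ne_zero hij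
    refine hτ.2.1 j (mem_cone.2 ⟨i, ?_⟩)
    rw [← h1, hroots]
    exact Multiset.mem_singleton_self _
  refine ⟨{ f := Sum.elim η.f g, res := Sum.elim η.res fun i => (τ i).2, αx := η.αx, αy := η.αy,
            irreducible := ?_, distinct := ?_, res_ne_zero := ?_, closed := η.closed },
    { params := hτ, f_inl := fun _ => rfl, res_inl := fun _ => rfl, αx_eq := rfl, αy_eq := rfl,
      res_inr := fun _ => rfl, smooth := horder, tangent := hroot, params_symm := ?_,
      eqs_symm := ?_ }⟩
  · rintro (i | i)
    · exact η.irreducible i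
    · exact hirr i
  · rintro (i | i) (j | j) hij h
    · exact η.distinct i j (fun h0 => hij (congrArg _ h0)) h
    · exact hmixed i j h
    · exact hmixed j i h.symm
    · have h1 := roots_conePoly_of_associated E (hirr i).ne_zero h
      have h2 : (conePoly E (g j)).roots = (conePoly E (g i)).roots := h1
      rw [hroots, hroots, Multiset.singleton_inj] at h2
      exact hij (congrArg _ (hτ.1 h2.symm))
  · rintro (i | i)
    · exact η.res_ne_zero i
    · exact hτ.2.2 i
  · exact fun i => ⟨i, by rw [hal]; simp⟩
  · refine fun i => ⟨i, ?_⟩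
    exact (conj_linForm (by simp) (by simp)).symm

end Modification

/-- At an escape point the leading form vanishes. At infinity this contradicts the degree condition;
at a finite real t off the cone it forces P_η(t) = 0. -/
theorem noRealEscapePoints_of_escapePoly {E : GL (Fin 2) ℝ} {N : ℕ} (hN : η.totalOrd = N + 1)
    (hres : η.MainResonant)
    (he : ∀ i, MvPolynomial.eval (fun k => ((E k 1 : ℝ) : ℂ)) (initForm (η.f i)) ≠ 0)
    (hP : η.escapePoly E ≠ 0) (hdeg : (η.escapePoly E).natDegree + 2 = (η.cone E).card)
    (hreal : ∀ t : ℝ, (t : ℂ) ∉ η.cone E → (η.escapePoly E).eval (t : ℂ) ≠ 0) :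
    η.NoRealEscapePoints := by
  intro v hv
  have hhom := leadForm_isHomogeneous (η := η) hN
  have hlead : ∀ k, MvPolynomial.eval (fun k => (v k : ℂ)) (η.leadForm k) = 0 := fun k => by
    by_contra hk
    exact not_isEscapePoint hN hres hk hv
  obtain ⟨hv0, hvi, -⟩ := hv
  have hdet : E 0 0 * E 1 1 - E 0 1 * E 1 0 ≠ 0 := by exact_mod_cast det_ne_zero E
  -- v = c E(1, 0) + d E(0, 1): the line [v] is t = ∞ if c = 0, and t = d/c otherwise.
  obtain ⟨c, d, hcd⟩ : ∃ c d : ℝ, ∀ k, v k = c * E k 0 + d * E k 1 := by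
    refine ⟨(v 0 * E 1 1 - v 1 * E 0 1) / (E 0 0 * E 1 1 - E 0 1 * E 1 0),
      (E 0 0 * v 1 - E 1 0 * v 0) / (E 0 0 * E 1 1 - E 0 1 * E 1 0), fun k => ?_⟩
    rw [div_mul_eq_mul_div, div_mul_eq_mul_div, ← add_div, eq_div_iff hdet]
    fin_cases k
    · simp only [Fin.zero_eta]; ring
    · simp only [Fin.mk_one]; ring
  by_cases hc : c = 0
  · have hvd : (fun k => (v k : ℂ)) = fun k => (d : ℂ) * ((E k 1 : ℝ) : ℂ) := by
      funext k
      rw [hcd, hc]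
      push_cast
      ring
    have hd : (d : ℂ) ≠ 0 := fun h => hv0 (by rw [hvd, h]; funext k; simp)
    obtain ⟨k, hk⟩ := (exists_leadForm_ne_zero_iff hN hres he).2 ⟨hP, hdeg⟩
    have h := hlead k
    rw [hvd, eval_smul_of_isHomogeneous (hhom k)] at h
    exact mul_ne_zero (pow_ne_zero _ hd) hk h
  · have hc' : (c : ℂ) ≠ 0 := by exact_mod_cast hc
    obtain ⟨t, ht⟩ : ∃ t : ℝ, t = d / c := ⟨_, rfl⟩
    have hvt : (fun k => (v k : ℂ)) =
        fun k => (c : ℂ) * (((E k 0 : ℝ) : ℂ) + ((E k 1 : ℝ) : ℂ) * (t : ℂ)) := by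
      funext k
      rw [hcd, ht]
      push_cast
      field_simp
    have hp : ∀ i, (conePoly E (η.f i)).eval (t : ℂ) ≠ 0 := fun i h0 => by
      refine hvi i ?_
      rw [hvt, initForm_eq_homPart, eval_smul_of_isHomogeneous (homPart_isHomogeneous _ _),
        ← initForm_eq_homPart]
      rw [conePoly_eq_lineEval, eval_lineEval] at h0
      rw [h0, mul_zero]
    have hK : (η.coneLogNum E).eval (t : ℂ) = 0 := by
      have h : ∀ k, MvPolynomial.eval (fun k => ((E k 0 : ℝ) : ℂ) + ((E k 1 : ℝ) : ℂ) * (t : ℂ))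
          (η.leadForm k) = 0 := fun k => by
        have h1 := hlead k
        rw [hvt, eval_smul_of_isHomogeneous (hhom k)] at h1
        exact (mul_eq_zero.1 h1).resolve_left (pow_ne_zero _ hc')
      rw [coneLogNum_eq, eval_add, eval_mul, eval_mul, eval_lineEval, eval_lineEval, h, h]
      simp
    have hcone : (t : ℂ) ∉ η.cone E := fun h => by
      obtain ⟨i, hi⟩ := mem_cone.1 h
      exact hp i (isRoot_of_mem_roots hi)
    have h := congrArg (eval (t : ℂ))
      (escapePoly_mul_prod (η := η) (E := E) fun i => (conePoly_natDegree (he i)).1)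
    rw [eval_mul, eval_mul, hK, zero_mul, eval_prod] at h
    exact mul_ne_zero (hreal t hcone) (Finset.prod_ne_zero_iff.2 fun i _ => hp i) h

/-- The residues found on the real line are used as parameters. The escape polynomial of a
modification depends only on the parameters and not on the smooth branches chosen, so the conclusion
holds for all of them. -/
theorem IsSymmetric.exists_modification_params (hsymm : η.IsSymmetric) (hres : η.MainResonant)
    {E : GL (Fin 2) ℝ} (hE : η.Adapted E) {ε : ℝ} (hε : 0 < ε) :
    ∃ (s : ℕ) (a : Fin s → ℝ) (l : Fin s → ℚ) (τ : Fin s → ℂ × ℂ),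
      0 < s ∧ (∀ i, τ i = ((a i : ℂ), (l i : ℂ))) ∧ (∀ i, |(l i : ℝ)| < ε) ∧
      (∃ η' : LogForm (ι ⊕ Fin s), η.IsSymmetricModification E τ η') ∧
      ∀ η' : LogForm (ι ⊕ Fin s), η.IsSymmetricModification E τ η' →
        η.IsBalanced E τ η' ∧ η'.NoRealEscapePoints := by
  obtain ⟨he, hP0, hPdeg⟩ := hE
  obtain ⟨P, Q, hP, hQ⟩ := hsymm.exists_real_escapePoly E
  have hQcone : ∀ t : ℝ, Q.eval t = 0 ↔ (t : ℂ) ∈ η.cone E := fun t => by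
    rw [← eval_poleProd_eq_zero, ← hQ]
    have : eval (t : ℂ) (Q.map Complex.ofRealHom) = Complex.ofRealHom (Q.eval t) :=
      eval_map_apply Complex.ofRealHom t
    rw [this]
    simp
  have hQdeg : Q.natDegree = (η.cone E).card := by
    rw [← natDegree_poleProd, ← hQ, natDegree_map]
  have hP0' : P ≠ 0 := fun h => hP0 (by rw [← hP, h, Polynomial.map_zero])
  rw [← hP, natDegree_map, ← hQdeg] at hPdeg
  obtain ⟨S, l, hS, hl, hsum, hne, hdeg, hroot⟩ := exists_balanced_residues hP0' hPdeg hε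
  set a : Fin S.card → ℝ := fun i => (S.equivFin.symm i : ℝ) with ha
  have haS : ∀ i, a i ∈ S := fun i => (S.equivFin.symm i).2
  have hainj : Function.Injective a := Subtype.val_injective.comp S.equivFin.symm.injective
  set τ : Fin S.card → ℂ × ℂ := fun i => ((a i : ℂ), (l (a i) : ℂ)) with hτ
  have hparam : η.IsParameterSet E τ := by
    refine ⟨fun i j hij => hainj (Complex.ofReal_injective hij), fun i h => ?_, fun i => ?_⟩
    · exact (hl _ (haS i)).1 ((hQcone _).2 h)
    · exact Rat.cast_ne_zero.2 (hl _ (haS i)).2.1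
  have himage : (Finset.univ.image fun i => (τ i).1) = S.image Complex.ofRealHom := by
    ext z
    simp only [Finset.mem_image, Finset.mem_univ, true_and]
    constructor
    · rintro ⟨i, rfl⟩
      exact ⟨a i, haS i, rfl⟩
    · rintro ⟨x, hx, rfl⟩
      refine ⟨S.equivFin ⟨x, hx⟩, ?_⟩
      simp [hτ, ha]
  have hτsum : ∑ i, (τ i).2 = 0 := by
    have h1 : ∑ i, l (a i) = ∑ x ∈ S, l x := by
      rw [← Finset.sum_coe_sort S l, ← Equiv.sum_comp S.equivFin.symm]
    have h2 : ∑ i, (τ i).2 = ((∑ i, l (a i) : ℚ) : ℂ) := by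
      rw [Rat.cast_sum]
    rw [h2, h1, hsum, Rat.cast_zero]
  refine ⟨S.card, a, fun i => l (a i), τ, Finset.card_pos.2 hS, fun i => rfl,
    fun i => (hl _ (haS i)).2.2, ?_, fun η' h => ?_⟩
  · exact exists_isSymmetricModification hparam a (fun i => (l (a i) : ℝ)) fun i => by simp [hτ]
  have hmod := h.toIsModification
  have hesc : η'.escapePoly E =
      (P * poleProd S + Q * polarNum S fun t => (l t : ℝ)).map Complex.ofRealHom := by
    -- All the new points are real, so taking the real part extends l to a residue function on ℂ.
    rw [hmod.escapePoly_eq (d := fun z => (l z.re : ℂ)) fun i => by simp [hτ], himage,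
      Polynomial.map_add, Polynomial.map_mul, Polynomial.map_mul, hP, hQ, map_poleProd,
      map_polarNum Complex.ofRealHom S _ (fun z => (l z.re : ℂ)) fun x _ => by simp]
  have hesc0 : η'.escapePoly E ≠ 0 := by
    rw [hesc]
    exact (Polynomial.map_ne_zero_iff Complex.ofRealHom.injective).2 hne
  have hescdeg : (η'.escapePoly E).natDegree + 2 = (η.cone E).card + S.card := by
    rw [hesc, natDegree_map, hdeg, hQdeg]
  refine ⟨⟨hτsum, hesc0, hescdeg⟩, ?_⟩
  have : Nonempty (ι ⊕ Fin S.card) := ⟨Sum.inr ⟨0, Finset.card_pos.2 hS⟩⟩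
  obtain ⟨N, hN⟩ := totalOrd_pos (η := η')
  refine noRealEscapePoints_of_escapePoly (E := E) hN (hmod.mainResonant hres hτsum)
    (hmod.eval_initForm_ne_zero he) hesc0 ?_ fun t ht => ?_
  · rw [hescdeg, hmod.cone_eq, Finset.card_union_of_disjoint hmod.disjoint_cone,
      Finset.card_image_of_injective _ hparam.1, Finset.card_univ, Fintype.card_fin]
  · rw [hmod.cone_eq, Finset.mem_union, not_or] at ht
    have h1 : eval (t : ℂ) (η'.escapePoly E) = Complex.ofRealHom
        ((P * poleProd S + Q * polarNum S fun t => (l t : ℝ)).eval t) := by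
      rw [hesc]
      exact eval_map_apply Complex.ofRealHom t
    rw [h1]
    exact (map_ne_zero Complex.ofRealHom).2 (hroot t fun h0 => ht.1 ((hQcone t).1 h0))

end LogForm

end LogModel

end

theorem mainTheorem9 {ι : Type*} [Fintype ι] (η : LogModel.LogForm ι)
    (hsymm : η.IsSymmetric) (hres : η.MainResonant) (hfaith : η.OneFaithful) :
    (∃ E : GL (Fin 2) ℝ, η.Adapted E) ∧
    ∀ E : GL (Fin 2) ℝ, η.Adapted E → ∀ ε : ℝ, 0 < ε →
      ∃ (s : ℕ) (a : Fin s → ℝ) (l : Fin s → ℚ) (τ : Fin s → ℂ × ℂ),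
        0 < s ∧ (∀ i, τ i = ((a i : ℂ), (l i : ℂ))) ∧ (∀ i, |(l i : ℝ)| < ε) ∧
        (∃ η' : LogModel.LogForm (ι ⊕ Fin s), η.IsSymmetricModification E τ η') ∧
        ∀ η' : LogModel.LogForm (ι ⊕ Fin s), η.IsSymmetricModification E τ η' →
          η.IsBalanced E τ η' ∧ η'.NoRealEscapePoints := by
  exact ⟨LogModel.LogForm.exists_adapted hres hfaith, fun _ hE _ hε =>
    hsymm.exists_modification_params hres hE hε⟩
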